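/- Let $q:\mathbb R\to\mathbb R$ be integrable over $\mathbb R$. Consider the Schrödinger operator $H=-\frac{d^2}{dx^2}+x^2+q(x)$ on $L^2(\mathbb R)$: an eigenfunction for $\mu\in\mathbb R$ is a nonzero $u\in L^2(\mathbb R)$, differentiable with locally absolutely continuous derivative, with $-u''+(x^2+q)u=\mu u$ almost everywhere. Let $H_j$ be the Hermite polynomials orthogonal for the weight $e^{-x^2}$ ($H_0=1$, $H_{j+1}=2xH_j-H_j'$), and let $$q_j=\frac{1}{\sqrt{\pi}\,2^j\,j!}\int_{\mathbb R}e^{-x^2}q(x)H_j(x)\,dx\qquad(j=0,1,2,\dots)$$ be the Hermite coefficients of $q$ (the coefficients in $q=\sum_j q_jH_j$ when $q\in L^2(\mathbb R,e^{-x^2}dx)$). Let $\lambda_k^0=2k+1$ denote the eigenvalues of the harmonic oscillator $-\frac{d^2}{dx^2}+x^2$. Then the eigenvalues of $H$, repeated according to multiplicity, form a sequence $\lambda_0\le\lambda_1\le\lambda_2\le\dots\to\infty$, and for every integer $n\ge 0$ $$\sum_{k=0}^n\left[\lambda_k-\lambda_k^0-\frac{1}{\pi\sqrt{\lambda_k^0}}\int_{\mathbb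 R}q(x)\,dx\right]\le\sum_{k=0}^n\left[\frac{2^k(2k)!}{k!}\binom{n+1}{k+1}q_{2k}-\frac{1}{\pi\sqrt{\lambda_k^0}}\int_{\mathbb R}q(x)\,dx\right].$$ -/

import Mathlib

open MeasureTheory Filter Polynomial
open scoped Nat

/-- The (physicists') Hermite polynomials `H_k`, orthogonal for the weight `e^{-x²}`:
`H_0 = 1` and `H_{k+1} = 2 x H_k - H_k'`. -/
noncomputable def hermiteH : ℕ → ℝ[X]
  | 0 => 1
  | k + 1 => 2 * X * hermiteH k - derivative (hermiteH k)

/-- The `j`-th Hermite coefficient `q_j` in the expansion `q = ∑ q_j H_j` with respect to the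
weight `e^{-x²}`; the normalising constant is `∫ e^{-x²} H_j(x)² dx = √π 2^j j!`. -/
noncomputable def hermiteCoeff (q : ℝ → ℝ) (j : ℕ) : ℝ :=
  (∫ x : ℝ, Real.exp (-x ^ 2) * q x * (hermiteH j).eval x) / (√Real.pi * 2 ^ j * (j ! : ℝ))

/-- The eigenspace, for the value `μ`, of the Schrödinger operator `-d²/dx² + V` on `L²(ℝ)`:
all square integrable `u`, differentiable with locally absolutely continuous derivative,
such that `-u'' + V u = μ u` almost everywhere. (Then `-u'' + V u` is again in `L²(ℝ)`, so `u` is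
in the maximal domain of the operator. Two members that agree almost everywhere are equal, being
continuous, so that this is the eigenspace inside `L²(ℝ)`.) -/
noncomputable def schrodingerEigenspace (V : ℝ → ℝ) (μ : ℝ) : Submodule ℝ (ℝ → ℝ) where
  carrier := {u | Differentiable ℝ u ∧
    (∀ a b : ℝ, AbsolutelyContinuousOnInterval (deriv u) a b) ∧
    MemLp u 2 volume ∧
    ∀ᵐ x : ℝ, -deriv (deriv u) x + V x * u x = μ * u x}
  zero_mem' := by
    have h0 : deriv (0 : ℝ → ℝ) = 0 := by ext x; simp
    refine ⟨differentiable_const 0, fun a b => ?_, MemLp.zero, ?_⟩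
    · rw [h0]
      exact (contDiffOn_const (c := (0 : ℝ))).absolutelyContinuousOnInterval
    · rw [h0, h0]
      simp
  add_mem' := by
    rintro u v ⟨hu, hu', hu2, hue⟩ ⟨hv, hv', hv2, hve⟩
    have hd : deriv (u + v) = deriv u + deriv v := by
      ext x; exact deriv_add (hu x) (hv x)
    have key : ∀ w : ℝ → ℝ, (∀ a b : ℝ, AbsolutelyContinuousOnInterval w a b) →
        ∀ᵐ x : ℝ, DifferentiableAt ℝ w x := by
      intro w hw
      have h1 : ∀ n : ℕ, ∀ᵐ x : ℝ, x ∈ Set.uIcc (-(n : ℝ)) n → DifferentiableAt ℝ w x :=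
        fun n => (hw _ _).ae_differentiableAt
      filter_upwards [ae_all_iff.2 h1] with x hx
      obtain ⟨n, hn⟩ := exists_nat_ge |x|
      refine hx n ?_
      rw [Set.uIcc_of_le (by linarith [abs_nonneg x])]
      exact ⟨by linarith [neg_abs_le x], by linarith [le_abs_self x]⟩
    refine ⟨hu.add hv, fun a b => ?_, hu2.add hv2, ?_⟩
    · rw [hd]; exact (hu' a b).add (hv' a b)
    · filter_upwards [key _ hu', key _ hv', hue, hve] with x h1 h2 h3 h4
      rw [hd, deriv_add h1 h2, Pi.add_apply]
      linear_combination h3 + h4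
  smul_mem' := by
    rintro c u ⟨hu, hu', hu2, hue⟩
    have hd : ∀ w : ℝ → ℝ, deriv (c • w) = c • deriv w := by
      intro w; ext x; exact deriv_const_smul_field c w
    refine ⟨hu.const_smul c, fun a b => ?_, hu2.const_smul c, ?_⟩
    · rw [hd]; exact (hu' a b).const_smul c
    · filter_upwards [hue] with x hx
      rw [hd, hd]
      simp only [Pi.smul_apply, smul_eq_mul]
      linear_combination c * hx

/-- `l 0 ≤ l 1 ≤ l 2 ≤ …` is the list of all eigenvalues of `-d²/dx² + V` on `L²(ℝ)`, each
repeated according to its multiplicity: every real `μ` occurs exactly as many times as the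
dimension of its eigenspace. -/
structure IsEigenvalueSequence (V : ℝ → ℝ) (l : ℕ → ℝ) : Prop where
  monotone : Monotone l
  multiplicity : ∀ μ : ℝ,
    Cardinal.mk {k : ℕ // l k = μ} = Module.rank ℝ (schrodingerEigenspace V μ)

/-- The eigenvalues `λ_k⁰ = 2k + 1` of the quantum harmonic oscillator `-d²/dx² + x²`. -/
def harmonicEigenvalue (k : ℕ) : ℝ := 2 * k + 1

/-!
The quadratic form of `H`, shifted by a constant, is coercive on the form domain of the harmonic
oscillator: by a Sobolev inequality an integrable potential is a small perturbation. The form domain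
embeds compactly into `L²(ℝ)`, so the eigenvectors of the form are a Hilbert basis, and they are the
classical eigenfunctions of `H`. The sum of the first `n + 1` eigenvalues is at most the sum of the
energies of any `n + 1` orthonormal functions of the form domain. For the normalized Hermite
functions `h_k` this gives `∑ (λ_k - λ_k⁰) ≤ ∑ ∫ q h_k²`, and the linearization formula for `H_k²`
together with `∑_{m ≤ n} (m choose k) = (n + 1 choose k + 1)` turns the right-hand side into
Hermite coefficients of `q`.
-/

/-! ### Enumerating a family of reals in increasing order -/

theorem nonempty_orderIso_nat_of_finite_Iic {I : Type*} [LinearOrder I] [Infinite I]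
    (hfin : ∀ i : I, (Set.Iic i).Finite) : Nonempty (ℕ ≃o I) := by
  classical
  obtain ⟨a⟩ : Nonempty I := inferInstance
  obtain ⟨m, hma, hmin⟩ :=
    Set.exists_min_image (Set.Iic a) id (hfin a) ⟨a, Set.self_mem_Iic⟩
  let _ : OrderBot I :=
    { bot := m
      bot_le := fun j => (le_total j a).elim (hmin j) (hma.trans ·) }
  have : NoMaxOrder I := ⟨fun i => by
    by_contra! hi
    exact Set.infinite_univ ((hfin i).subset fun j _ => hi j)⟩
  let _ : LocallyFiniteOrder I := LocallyFiniteOrder.ofFiniteIcc fun _ b =>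
    (hfin b).subset Set.Icc_subset_Iic_self
  let _ : SuccOrder I := LinearLocallyFiniteOrder.succOrder I
  let _ : PredOrder I := LinearLocallyFiniteOrder.predOrder I
  exact ⟨orderIsoNatOfLinearSuccPredArch.symm⟩

theorem exists_equiv_monotone_of_tendsto_cofinite {I : Type*} [Infinite I] {f : I → ℝ}
    (hf : Tendsto f cofinite atTop) : ∃ σ : ℕ ≃ I, Monotone (f ∘ σ) := by
  have : Countable I := by
    have hker : (atTop : Filter ℝ).ker = ∅ := Set.eq_empty_of_forall_notMem fun x hx =>
      lt_irrefl x (mem_ker.1 hx _ (Ioi_mem_atTop x))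
    simpa [← Set.countable_univ_iff, hker] using hf.countable_compl_preimage_ker
  obtain ⟨e, he⟩ := exists_injective_nat I
  -- Ties between equal values of `f` are broken by an arbitrary numbering `e` of `I`.
  let key : I → ℝ ×ₗ ℕ := fun i => toLex (f i, e i)
  have hkey : Function.Injective key := fun i j hij => he (congrArg (fun z => (ofLex z).2) hij)
  let _ : LinearOrder I := LinearOrder.lift' key hkey
  have hmono : Monotone f := fun i j (hij : key i ≤ key j) =>
    (Prod.Lex.le_iff.1 hij).elim le_of_lt fun h => h.1.le
  have hfin : ∀ M, {i | f i ≤ M}.Finite := fun M => by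
    simpa [eventually_cofinite] using hf.eventually_gt_atTop M
  obtain ⟨σ⟩ := nonempty_orderIso_nat_of_finite_Iic fun i : I =>
    (hfin (f i)).subset fun _ hj => hmono hj
  exact ⟨σ.toEquiv, hmono.comp σ.monotone⟩

/-! ### Eigenvalues of a coercive form with compactly embedded domain -/

section FormEigenspaces

open scoped InnerProductSpace

variable {E L : Type*} [NormedAddCommGroup E] [InnerProductSpace ℝ E]
  [NormedAddCommGroup L] [InnerProductSpace ℝ L]

/-- The eigenspace `{e | B(e, ·) = μ ⟪J e, J ·⟫}` of a bilinear form `B`, relative to the map `J`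
from the form domain `E` to the ambient Hilbert space `L`. -/
def formEigenspace (J : E →L[ℝ] L) (B : E →L[ℝ] E →L[ℝ] ℝ) (μ : ℝ) : Submodule ℝ E where
  carrier := {e | ∀ f, B e f = μ * ⟪J e, J f⟫_ℝ}
  zero_mem' := by simp
  add_mem' := by
    intro a b ha hb f
    simp only [map_add, add_apply, inner_add_left, ha f, hb f]
    ring
  smul_mem' := by
    intro c a ha f
    simp only [map_smul, smul_apply, real_inner_smul_left, ha f, smul_eq_mul]
    ring

/-- The image of `formEigenspace J B μ` in the ambient Hilbert space. -/
def ambientEigenspace (J : E →L[ℝ] L) (B : E →L[ℝ] E →L[ℝ] ℝ) (μ : ℝ) : Submodule ℝ L :=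
  (formEigenspace J B μ).map (J : E →ₗ[ℝ] L)

/-- `l 0 ≤ l 1 ≤ …` lists the eigenvalues of the form `B`, each repeated according to its
multiplicity. The multiplicity is expressed through bases rather than cardinalities, so that `E`
may live in any universe. -/
structure IsFormEigenvalueSequence (J : E →L[ℝ] L) (B : E →L[ℝ] E →L[ℝ] ℝ) (l : ℕ → ℝ) :
    Prop where
  monotone : Monotone l
  nonempty_basis : ∀ μ, Nonempty (Module.Basis {k : ℕ // l k = μ} ℝ (formEigenspace J B μ))

variable {J : E →L[ℝ] L} {B : E →L[ℝ] E →L[ℝ] ℝ} {μ : ℝ}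

theorem mem_formEigenspace {e : E} :
    e ∈ formEigenspace J B μ ↔ ∀ f, B e f = μ * ⟪J e, J f⟫_ℝ := Iff.rfl

theorem mem_ambientEigenspace {x : L} :
    x ∈ ambientEigenspace J B μ ↔ ∃ e ∈ formEigenspace J B μ, J e = x := Iff.rfl

theorem eq_zero_of_isCoercive (hB : IsCoercive B) {e : E} (he : B e e ≤ 0) : e = 0 := by
  obtain ⟨C, hC, hCB⟩ := hB
  have hnorm : C * ‖e‖ * ‖e‖ ≤ 0 := (hCB e).trans he
  by_contra hne
  have := norm_pos_iff.2 hne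
  have : 0 < C * ‖e‖ * ‖e‖ := by positivity
  linarith

theorem isCoercive_apply_self_nonneg (hB : IsCoercive B) (e : E) : 0 ≤ B e e := by
  obtain ⟨C, hC, hCB⟩ := hB
  exact le_trans (by positivity) (hCB e)

/-- `J` restricts to an isomorphism between the two models of the eigenspace. -/
noncomputable def formEigenspaceEquiv (hB : IsCoercive B) (μ : ℝ) :
    formEigenspace J B μ ≃ₗ[ℝ] ambientEigenspace J B μ :=
  LinearEquiv.ofBijective ((J : E →ₗ[ℝ] L).submoduleMap (formEigenspace J B μ)) (by
    refine ⟨?_, LinearMap.submoduleMap_surjective _ _⟩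
    rw [← LinearMap.ker_eq_bot, LinearMap.ker_eq_bot']
    intro e he
    have hJe : J e = 0 := congrArg Subtype.val he
    exact Subtype.ext (eq_zero_of_isCoercive hB (by simp [e.2 e, hJe])))

theorem ambientEigenspace_zero (hB : IsCoercive B) : ambientEigenspace J B 0 = ⊥ := by
  refine eq_bot_iff.2 ?_
  rintro _ ⟨e, he, rfl⟩
  have : e = 0 := eq_zero_of_isCoercive hB (by rw [he e, zero_mul])
  simp [this]

theorem orthogonalFamily_ambientEigenspace (hs : ∀ e f, B e f = B f e) :
    OrthogonalFamily ℝ (fun μ => ambientEigenspace J B μ)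
      (fun μ => (ambientEigenspace J B μ).subtypeₗᵢ) := by
  rintro μ ν hμν ⟨_, e, he, rfl⟩ ⟨_, f, hf, rfl⟩
  have hmul : (μ - ν) * ⟪J e, J f⟫_ℝ = 0 := by
    rw [sub_mul, ← he f, hs, hf e, real_inner_comm, sub_self]
  exact (mul_eq_zero.1 hmul).resolve_left (sub_ne_zero.2 hμν)

/-- Eigenvectors with eigenvalues below `M` are bounded in `E`, so their images have compact
closure, but distinct members of an orthonormal family stay at distance `√2`. -/
theorem tendsto_eigenvalue_cofinite_atTop (hJ : IsCompactOperator J) (hB : IsCoercive B)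
    {I : Type*} {b : I → L} (hb : Orthonormal ℝ b) {l : I → ℝ}
    (hbl : ∀ i, b i ∈ ambientEigenspace J B (l i)) : Tendsto l cofinite atTop := by
  refine tendsto_atTop.2 fun M => ?_
  rw [eventually_cofinite]
  by_contra hinf
  let ι := Set.Infinite.natEmbedding _ hinf
  choose e he hJe using fun n : ℕ => mem_ambientEigenspace.1 (hbl (ι n))
  obtain ⟨C, hC, hCB⟩ := hB
  have hbound : ∀ n, e n ∈ Metric.closedBall (0 : E) (√(M / C)) := by
    intro n
    have hlM : l (ι n) ≤ M := (not_le.1 (ι n).2).le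
    have hCe := hCB (e n)
    rw [he n, hJe n, real_inner_self_eq_norm_sq, hb.1] at hCe
    rw [mem_closedBall_zero_iff]
    refine Real.le_sqrt_of_sq_le ((le_div_iff₀ hC).2 ?_)
    linarith
  obtain ⟨K, hK, hKJ⟩ := hJ.image_closedBall_subset_compact (√(M / C))
  have hmem : ∀ n, b (ι n) ∈ K := fun n => hKJ ⟨e n, hbound n, hJe n⟩
  obtain ⟨_, -, ψ, hψ, hlim⟩ := hK.tendsto_subseq hmem
  obtain ⟨N, hN⟩ := Metric.cauchySeq_iff'.1 hlim.cauchySeq 1 one_pos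
  have hclose : dist (b (ι (ψ (N + 1)))) (b (ι (ψ N))) < 1 := hN (N + 1) N.le_succ
  have hne : (ι (ψ (N + 1)) : I) ≠ ι (ψ N) := fun h =>
    N.succ_ne_self (hψ.injective (ι.injective (Subtype.ext h)))
  have hdist : dist (b (ι (ψ (N + 1)))) (b (ι (ψ N))) ^ 2 = 2 := by
    rw [dist_eq_norm, norm_sub_sq_real, hb.1, hb.1, hb.2 hne]
    norm_num
  nlinarith [dist_nonneg (x := b (ι (ψ (N + 1)))) (y := b (ι (ψ N)))]

/-- Expand `0 ≤ B(u - s, u - s)`, where `s` lifts the partial expansion of `J u` along the given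
eigenvectors. -/
theorem sum_eigenvalue_mul_inner_sq_le (hpos : ∀ e, 0 ≤ B e e) (hs : ∀ e f, B e f = B f e)
    {ι : Type*} {b : ι → L} (hb : Orthonormal ℝ b) {l : ι → ℝ}
    (hbl : ∀ j, b j ∈ ambientEigenspace J B (l j)) (u : E) (t : Finset ι) :
    ∑ j ∈ t, l j * ⟪b j, J u⟫_ℝ ^ 2 ≤ B u u := by
  choose e he hJe using fun j => mem_ambientEigenspace.1 (hbl j)
  let c : ι → ℝ := fun j => ⟪b j, J u⟫_ℝ
  let s : E := ∑ j ∈ t, c j • e j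
  have hJs : J s = ∑ j ∈ t, c j • b j := by
    simp only [s, map_sum, map_smul, hJe]
  have hBs : ∀ f, B s f = ∑ j ∈ t, c j * (l j * ⟪b j, J f⟫_ℝ) := fun f => by
    simp only [s, map_sum, map_smul, sum_apply, smul_apply, smul_eq_mul, he _ f, hJe]
  have hsu : B s u = ∑ j ∈ t, l j * c j ^ 2 := by
    rw [hBs]
    exact Finset.sum_congr rfl fun j _ => by ring
  have hss : B s s = ∑ j ∈ t, l j * c j ^ 2 := by
    rw [hBs]
    refine Finset.sum_congr rfl fun j hj => ?_
    rw [hJs, hb.inner_right_sum c hj]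
    ring
  have hsub := hpos (u - s)
  simp only [map_sub, sub_apply] at hsub
  rw [hs u s, hsu, hss] at hsub
  linarith

end FormEigenspaces

section Solution

open scoped InnerProductSpace

variable {E L : Type*} [NormedAddCommGroup E] [InnerProductSpace ℝ E] [CompleteSpace E]
  [NormedAddCommGroup L] [InnerProductSpace ℝ L] [CompleteSpace L]
  {J : E →L[ℝ] L} {B : E →L[ℝ] E →L[ℝ] ℝ}

/-- The Lax-Milgram solution operator: `formSolution J hB x` is the `e` with
`B(e, ·) = ⟪x, J ·⟫`. -/
noncomputable def formSolution (J : E →L[ℝ] L) (hB : IsCoercive B) : L →L[ℝ] E :=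
  (hB.continuousLinearEquivOfBilin.symm : E →L[ℝ] E) ∘L ContinuousLinearMap.adjoint J

theorem apply_formSolution (hB : IsCoercive B) (x : L) (f : E) :
    B (formSolution J hB x) f = ⟪x, J f⟫_ℝ := by
  simp [← hB.continuousLinearEquivOfBilin_apply, formSolution,
    ContinuousLinearMap.adjoint_inner_left]

theorem eq_formSolution (hB : IsCoercive B) {e : E} {x : L} (h : ∀ f, B e f = ⟪x, J f⟫_ℝ) :
    e = formSolution J hB x :=
  sub_eq_zero.1 (eq_zero_of_isCoercive hB (by
    rw [map_sub B, sub_apply, h, apply_formSolution, sub_self]))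

/-- The inverse of the operator associated with the form `B`, acting on the ambient space. -/
noncomputable def formInverse (J : E →L[ℝ] L) (hB : IsCoercive B) : L →L[ℝ] L :=
  J ∘L formSolution J hB

theorem formInverse_apply (hB : IsCoercive B) (x : L) :
    formInverse J hB x = J (formSolution J hB x) := rfl

theorem isSymmetric_formInverse (hB : IsCoercive B) (hs : ∀ e f, B e f = B f e) :
    (formInverse J hB).IsSymmetric := fun x y => by
  change ⟪J (formSolution J hB x), y⟫_ℝ = ⟪x, J (formSolution J hB y)⟫_ℝ
  rw [real_inner_comm, ← apply_formSolution hB, ← apply_formSolution hB, hs]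

theorem eq_zero_of_formInverse_eq_zero (hB : IsCoercive B) (hd : DenseRange J) {x : L}
    (hx : formInverse J hB x = 0) : x = 0 := by
  have hsol : formSolution J hB x = 0 := eq_zero_of_isCoercive hB (by
    rw [apply_formSolution, ← formInverse_apply, hx, inner_zero_right])
  exact hd.eq_zero_of_inner_left ℝ fun e => by
    rw [← apply_formSolution hB, hsol, map_zero, zero_apply]

theorem eigenspace_formInverse_le (hB : IsCoercive B) (hd : DenseRange J) (ν : ℝ) :
    Module.End.eigenspace (formInverse J hB : Module.End ℝ L) ν ≤ ambientEigenspace J B ν⁻¹ := by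
  intro x hx
  have hx : J (formSolution J hB x) = ν • x := Module.End.mem_eigenspace_iff.1 hx
  rcases eq_or_ne ν 0 with rfl | hν
  · rw [eq_zero_of_formInverse_eq_zero hB hd (hx.trans (zero_smul ℝ x))]
    exact zero_mem _
  · refine mem_ambientEigenspace.2 ⟨ν⁻¹ • formSolution J hB x, fun f => ?_, ?_⟩
    · rw [map_smul, map_smul, hx, inv_smul_smul₀ hν, smul_apply, apply_formSolution, smul_eq_mul]
    · rw [map_smul, hx, inv_smul_smul₀ hν]

theorem ambientEigenspace_le_eigenspace_formInverse (hB : IsCoercive B) {μ : ℝ} (hμ : μ ≠ 0) :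
    ambientEigenspace J B μ ≤
      Module.End.eigenspace (formInverse J hB : Module.End ℝ L) μ⁻¹ := by
  rintro _ ⟨e, he, rfl⟩
  rw [Module.End.mem_eigenspace_iff]
  have hsol : e = formSolution J hB (μ • J e) := eq_formSolution hB fun f => by
    rw [he f, real_inner_smul_left]
  change J (formSolution J hB (J e)) = μ⁻¹ • J e
  conv_rhs => rw [hsol, map_smul, map_smul, inv_smul_smul₀ hμ]

theorem orthogonal_iSup_ambientEigenspace (hJ : IsCompactOperator J) (hB : IsCoercive B)
    (hs : ∀ e f, B e f = B f e) (hd : DenseRange J) : (⨆ μ, ambientEigenspace J B μ)ᗮ = ⊥ := by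
  have hcompact : IsCompactOperator (formInverse J hB) := hJ.comp_clm (formSolution J hB)
  rw [eq_bot_iff, ← ContinuousLinearMap.orthogonalComplement_iSup_eigenspaces_eq_bot hcompact
    (isSymmetric_formInverse hB hs)]
  exact Submodule.orthogonal_le (iSup_le fun ν =>
    (eigenspace_formInverse_le hB hd ν).trans (le_iSup (fun μ => ambientEigenspace J B μ) ν⁻¹))

theorem finiteDimensional_ambientEigenspace (hJ : IsCompactOperator J) (hB : IsCoercive B)
    (μ : ℝ) : FiniteDimensional ℝ (ambientEigenspace J B μ) := by
  rcases eq_or_ne μ 0 with rfl | hμ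
  · rw [ambientEigenspace_zero hB]
    infer_instance
  · have hcompact : IsCompactOperator (formInverse J hB) := hJ.comp_clm (formSolution J hB)
    have := ContinuousLinearMap.finite_dimensional_eigenspace hcompact μ⁻¹ (inv_ne_zero hμ)
    exact Submodule.finiteDimensional_of_le (ambientEigenspace_le_eigenspace_formInverse hB hμ)

theorem exists_hilbertBasis_of_orthonormalBasis_ambientEigenspace (hJ : IsCompactOperator J)
    (hB : IsCoercive B) (hs : ∀ e f, B e f = B f e) (hd : DenseRange J)
    {α : ℝ → Type*} [∀ μ, Fintype (α μ)]
    (v : ∀ μ, OrthonormalBasis (α μ) ℝ (ambientEigenspace J B μ)) :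
    ∃ b : HilbertBasis (Σ μ, α μ) ℝ L, ∀ i, b i = v i.1 i.2 := by
  have hortho : Orthonormal ℝ fun i : Σ μ, α μ => (v i.1 i.2 : L) :=
    (orthogonalFamily_ambientEigenspace hs).orthonormal_sigma_orthonormal
      fun μ => (v μ).orthonormal
  refine ⟨HilbertBasis.mkOfOrthogonalEqBot hortho ?_,
    fun i => by rw [HilbertBasis.coe_mkOfOrthogonalEqBot]⟩
  rw [eq_bot_iff, ← orthogonal_iSup_ambientEigenspace hJ hB hs hd]
  refine Submodule.orthogonal_le (iSup_le fun μ x hx => ?_)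
  have hrepr := congrArg Subtype.val ((v μ).sum_repr ⟨x, hx⟩)
  simp only [Submodule.coe_sum, Submodule.coe_smul] at hrepr
  rw [← hrepr]
  exact Submodule.sum_smul_mem _ _ fun i _ => Submodule.subset_span ⟨⟨μ, i⟩, rfl⟩

theorem exists_isFormEigenvalueSequence (hJ : IsCompactOperator J) (hB : IsCoercive B)
    (hs : ∀ e f, B e f = B f e) (hd : DenseRange J) (hL : ¬ FiniteDimensional ℝ L) :
    ∃ l : ℕ → ℝ, IsFormEigenvalueSequence J B l ∧ Tendsto l atTop atTop := by
  have hfin := finiteDimensional_ambientEigenspace hJ hB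
  obtain ⟨b, hb⟩ := exists_hilbertBasis_of_orthonormalBasis_ambientEigenspace hJ hB hs hd
    fun μ => stdOrthonormalBasis ℝ (ambientEigenspace J B μ)
  let I := Σ μ, Fin (Module.finrank ℝ (ambientEigenspace J B μ))
  have : Infinite I := by
    by_contra hI
    have := not_infinite_iff_finite.1 hI
    have := Fintype.ofFinite I
    exact hL (Module.Basis.finiteDimensional_of_finite b.toOrthonormalBasis.toBasis)
  have htop : Tendsto (fun i : I => i.1) cofinite atTop :=
    tendsto_eigenvalue_cofinite_atTop hJ hB b.orthonormal fun i => by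
      rw [hb]
      exact Subtype.mem _
  obtain ⟨σ, hσ⟩ := exists_equiv_monotone_of_tendsto_cofinite htop
  refine ⟨fun k => (σ k).1, ⟨hσ, fun μ => ⟨?_⟩⟩, ?_⟩
  · let fiber : {k : ℕ // (σ k).1 = μ} ≃ Fin (Module.finrank ℝ (ambientEigenspace J B μ)) :=
      (σ.subtypeEquiv fun k => Iff.rfl).trans (Equiv.sigmaSubtype μ)
    exact (((stdOrthonormalBasis ℝ _).toBasis.map (formEigenspaceEquiv hB μ).symm).reindex
      fiber.symm)
  · exact htop.comp (Nat.cofinite_eq_atTop ▸ σ.injective.tendsto_cofinite)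

theorem IsFormEigenvalueSequence.exists_hilbertBasis {l : ℕ → ℝ}
    (hl : IsFormEigenvalueSequence J B l) (hJ : IsCompactOperator J) (hB : IsCoercive B)
    (hs : ∀ e f, B e f = B f e) (hd : DenseRange J) :
    ∃ b : HilbertBasis ℕ ℝ L, ∀ k, b k ∈ ambientEigenspace J B (l k) := by
  have hfin := finiteDimensional_ambientEigenspace hJ hB
  have v : ∀ μ, Module.Basis {k : ℕ // l k = μ} ℝ (ambientEigenspace J B μ) := fun μ =>
    (hl.nonempty_basis μ).some.map (formEigenspaceEquiv hB μ)
  let _ : ∀ μ, Fintype {k : ℕ // l k = μ} := fun μ =>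
    FiniteDimensional.fintypeBasisIndex (v μ)
  obtain ⟨b, hb⟩ := exists_hilbertBasis_of_orthonormalBasis_ambientEigenspace hJ hB hs hd
    fun μ => (stdOrthonormalBasis ℝ (ambientEigenspace J B μ)).reindex
      (finCongr (Module.finrank_eq_card_basis (v μ)) |>.trans (Fintype.equivFin _).symm)
  let fiber : ℕ ≃ Σ μ, {k : ℕ // l k = μ} := (Equiv.sigmaFiberEquiv l).symm
  refine ⟨HilbertBasis.mkOfOrthogonalEqBot (b.orthonormal.comp fiber fiber.injective) ?_,
    fun k => ?_⟩
  · rw [fiber.surjective.range_comp]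
    exact (Submodule.topologicalClosure_eq_top_iff).1 b.dense_span
  · simp only [HilbertBasis.coe_mkOfOrthogonalEqBot, Function.comp_apply, hb]
    exact Subtype.mem _

end Solution

/-! ### The trace inequality -/

/-- The excess of the weights beyond index `n` is charged to `l n`. -/
theorem sum_range_le_of_weights {l p : ℕ → ℝ} (hl : Monotone l) (hp0 : ∀ j, 0 ≤ p j)
    (hp1 : ∀ j, p j ≤ 1) {n : ℕ} (hp : HasSum p (n + 1)) {S : ℝ}
    (hS : ∀ N, ∑ j ∈ Finset.range N, l j * p j ≤ S) :
    ∑ j ∈ Finset.range (n + 1), l j ≤ S := by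
  have hpartial : ∀ m, ∑ j ∈ Finset.range (n + 1), (l j - l n)
      + l n * ∑ j ∈ Finset.range (m + (n + 1)), p j ≤ S := by
    intro m
    have hexcess : ∑ j ∈ Finset.range (n + 1), (l j - l n)
        ≤ ∑ j ∈ Finset.range (m + (n + 1)), (l j - l n) * p j := calc
      _ ≤ ∑ j ∈ Finset.range (n + 1), (l j - l n) * p j := Finset.sum_le_sum fun j hj => by
        nlinarith [hl (Finset.mem_range_succ_iff.1 hj), hp1 j]
      _ ≤ _ := Finset.sum_le_sum_of_subset_of_nonneg
        (Finset.range_mono (Nat.le_add_left _ _)) fun j _ hj =>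
          mul_nonneg (sub_nonneg.2 (hl (by simp only [Finset.mem_range] at hj; omega))) (hp0 j)
    refine le_trans ?_ (hS (m + (n + 1)))
    simp only [sub_mul, Finset.sum_sub_distrib, Finset.mul_sum] at hexcess ⊢
    linarith
  have hlim : Tendsto (fun m => ∑ j ∈ Finset.range (n + 1), (l j - l n)
      + l n * ∑ j ∈ Finset.range (m + (n + 1)), p j) atTop
      (nhds (∑ j ∈ Finset.range (n + 1), (l j - l n) + l n * (n + 1))) :=
    ((hp.tendsto_sum_nat.comp (tendsto_add_atTop_nat (n + 1))).const_mul _).const_add _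
  refine le_of_eq_of_le ?_ (le_of_tendsto' hlim hpartial)
  simp [mul_comm]

section TraceInequality

open scoped InnerProductSpace

variable {E L : Type*} [NormedAddCommGroup E] [InnerProductSpace ℝ E]
  [NormedAddCommGroup L] [InnerProductSpace ℝ L] {J : E →L[ℝ] L} {B : E →L[ℝ] E →L[ℝ] ℝ}

theorem sum_eigenvalues_le_sum_form (hpos : ∀ e, 0 ≤ B e e) (hs : ∀ e f, B e f = B f e)
    {l : ℕ → ℝ} (hl : Monotone l) (b : HilbertBasis ℕ ℝ L)
    (hb : ∀ k, b k ∈ ambientEigenspace J B (l k)) {u : ℕ → E}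
    (hu : Orthonormal ℝ fun k => J (u k)) (n : ℕ) :
    ∑ k ∈ Finset.range (n + 1), l k ≤ ∑ k ∈ Finset.range (n + 1), B (u k) (u k) := by
  let p : ℕ → ℝ := fun j => ∑ k ∈ Finset.range (n + 1), ⟪b j, J (u k)⟫_ℝ ^ 2
  have hp1 : ∀ j, p j ≤ 1 := fun j => by
    simpa [p, real_inner_comm, b.orthonormal.1 j] using
      hu.sum_inner_products_le (b j) (s := Finset.range (n + 1))
  have hp : HasSum p (n + 1) := by
    have hparseval : ∀ k, HasSum (fun j => ⟪b j, J (u k)⟫_ℝ ^ 2) 1 := fun k => by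
      simpa [real_inner_self_eq_norm_sq, hu.1 k, real_inner_comm, sq] using
        b.hasSum_inner_mul_inner (J (u k)) (J (u k))
    simpa using hasSum_sum fun k (_ : k ∈ Finset.range (n + 1)) => hparseval k
  refine sum_range_le_of_weights hl (fun j => Finset.sum_nonneg fun k _ => sq_nonneg _) hp1 hp
    fun N => ?_
  simp_rw [Finset.mul_sum]
  rw [Finset.sum_comm]
  exact Finset.sum_le_sum fun k _ =>
    sum_eigenvalue_mul_inner_sq_le hpos hs b.orthonormal hb (u k) (Finset.range N)

end TraceInequality

/-! ### Hermite polynomials -/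

theorem hermiteH_succ (k : ℕ) :
    hermiteH (k + 1) = 2 * X * hermiteH k - derivative (hermiteH k) := rfl

theorem derivative_hermiteH_succ (k : ℕ) :
    derivative (hermiteH (k + 1)) = (2 * (k + 1) : ℝ) • hermiteH k := by
  induction k with
  | zero => simp [hermiteH, two_smul, two_mul]
  | succ k ih =>
    rw [hermiteH_succ (k + 1), derivative_sub, ih, derivative_smul, derivative_mul, ih,
      hermiteH_succ k]
    simp only [derivative_mul, derivative_ofNat, derivative_X, smul_eq_C_mul, map_mul, map_add,
      map_natCast, map_one, Nat.cast_add, Nat.cast_one, map_ofNat]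
    ring

theorem derivative_hermiteH (k : ℕ) :
    derivative (hermiteH k) = (2 * k : ℝ) • hermiteH (k - 1) := by
  cases k with
  | zero => simp [hermiteH]
  | succ k => simpa using derivative_hermiteH_succ k

/-- The coefficient of `H_{m + n - 2r}` in the expansion of `H_m H_n`. -/
def hermiteMulCoeff (m n r : ℕ) : ℕ := 2 ^ r * r ! * m.choose r * n.choose r

theorem hermiteMulCoeff_zero_right (m n : ℕ) : hermiteMulCoeff m n 0 = 1 := by
  simp [hermiteMulCoeff]

theorem hermiteMulCoeff_eq_zero_of_left_lt {m n r : ℕ} (h : m < r) :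
    hermiteMulCoeff m n r = 0 := by
  simp [hermiteMulCoeff, Nat.choose_eq_zero_of_lt h]

theorem hermiteMulCoeff_eq_zero_of_right_lt {m n r : ℕ} (h : n < r) :
    hermiteMulCoeff m n r = 0 := by
  simp [hermiteMulCoeff, Nat.choose_eq_zero_of_lt h]

theorem hermiteMulCoeff_succ_succ (m n r : ℕ) :
    hermiteMulCoeff m (n + 1) (r + 1)
      = hermiteMulCoeff m n (r + 1) + 2 * m * hermiteMulCoeff (m - 1) n r := by
  cases m with
  | zero => simp [hermiteMulCoeff]
  | succ m =>
    simp only [hermiteMulCoeff, Nat.add_sub_cancel, Nat.choose_succ_succ n r, Nat.factorial_succ]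
    have habsorb := Nat.add_one_mul_choose_eq m r
    grind

theorem hermiteH_mul_hermiteH_succ (m n : ℕ) :
    hermiteH m * hermiteH (n + 1)
      = (2 * X * (hermiteH m * hermiteH n) - derivative (hermiteH m * hermiteH n))
        + (2 * m : ℝ) • (hermiteH (m - 1) * hermiteH n) := by
  rw [hermiteH_succ, derivative_mul, derivative_hermiteH m, smul_mul_assoc]
  ring

theorem two_mul_X_mul_sum_sub_derivative_sum (s : Finset ℕ) (c : ℕ → ℝ) (k : ℕ → ℕ) :
    2 * X * ∑ r ∈ s, c r • hermiteH (k r) - derivative (∑ r ∈ s, c r • hermiteH (k r))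
      = ∑ r ∈ s, c r • hermiteH (k r + 1) := by
  simp_rw [derivative_sum, Finset.mul_sum, ← Finset.sum_sub_distrib, derivative_smul,
    mul_smul_comm, ← smul_sub, hermiteH_succ]

theorem hermiteH_mul_hermiteH (m n : ℕ) :
    hermiteH m * hermiteH n
      = ∑ r ∈ Finset.range (n + 1), (hermiteMulCoeff m n r : ℝ) • hermiteH (m + n - 2 * r) := by
  induction n generalizing m with
  | zero => simp [hermiteH, hermiteMulCoeff]
  | succ n ih =>
    have hraise : 2 * X * (hermiteH m * hermiteH n) - derivative (hermiteH m * hermiteH n)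
        = ∑ r ∈ Finset.range (n + 1 + 1),
          (hermiteMulCoeff m n r : ℝ) • hermiteH (m + (n + 1) - 2 * r) := by
      rw [ih, two_mul_X_mul_sum_sub_derivative_sum, Finset.sum_range_succ _ (n + 1),
        hermiteMulCoeff_eq_zero_of_right_lt n.lt_succ_self, Nat.cast_zero, zero_smul, add_zero]
      refine Finset.sum_congr rfl fun r hr => ?_
      rcases lt_or_ge m r with hmr | hrm
      · simp [hermiteMulCoeff_eq_zero_of_left_lt hmr]
      · rw [Finset.mem_range] at hr
        rw [show m + n - 2 * r + 1 = m + (n + 1) - 2 * r by omega]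
    have hlower : (2 * m : ℝ) • (hermiteH (m - 1) * hermiteH n)
        = ∑ r ∈ Finset.range (n + 1), ((2 * m * hermiteMulCoeff (m - 1) n r : ℕ) : ℝ) •
          hermiteH (m + (n + 1) - 2 * (r + 1)) := by
      rw [ih, Finset.smul_sum]
      refine Finset.sum_congr rfl fun r _ => ?_
      cases m with
      | zero => simp
      | succ m =>
        rw [smul_smul, show m + 1 - 1 + n - 2 * r = m + 1 + (n + 1) - 2 * (r + 1) by omega]
        push_cast
        rfl
    rw [hermiteH_mul_hermiteH_succ, hraise, hlower, Finset.sum_range_succ' _ (n + 1),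
      Finset.sum_range_succ' _ (n + 1), hermiteMulCoeff_zero_right, hermiteMulCoeff_zero_right]
    simp_rw [hermiteMulCoeff_succ_succ, Nat.cast_add, add_smul, Finset.sum_add_distrib]
    abel

theorem hermiteMulCoeff_self_div {i j : ℕ} :
    (1 / (2 ^ (j + i) * (j + i)!) : ℝ) * hermiteMulCoeff (j + i) (j + i) i
      = (j + i).choose j / (2 ^ j * j !) := by
  have hchoose : ((j + i).choose j : ℝ) * j ! * i ! = (j + i)! := by
    rw [Nat.choose_symm_add]
    exact_mod_cast Nat.add_choose_mul_factorial_mul_factorial j i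
  have hpos : ((j + i).choose j : ℝ) ≠ 0 := by
    exact_mod_cast (Nat.choose_pos (Nat.le_add_right j i)).ne'
  rw [← hchoose, hermiteMulCoeff, ← Nat.choose_symm_add, pow_add]
  push_cast
  field_simp

theorem hermiteH_sq_div (m : ℕ) :
    (1 / (2 ^ m * m !) : ℝ) • hermiteH m ^ 2
      = ∑ j ∈ Finset.range (m + 1), (m.choose j / (2 ^ j * j !) : ℝ) • hermiteH (2 * j) := by
  rw [sq, hermiteH_mul_hermiteH, Finset.smul_sum, ← Finset.sum_range_reflect]
  refine Finset.sum_congr rfl fun j hj => ?_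
  obtain ⟨i, rfl⟩ := Nat.exists_eq_add_of_le (Finset.mem_range_succ_iff.1 hj)
  rw [show j + i + 1 - 1 - j = i by omega, show j + i + (j + i) - 2 * i = 2 * j by omega,
    smul_smul, hermiteMulCoeff_self_div]

theorem sum_range_succ_choose (n j : ℕ) :
    ∑ m ∈ Finset.range (n + 1), m.choose j = (n + 1).choose (j + 1) := by
  rw [← Nat.sum_Icc_choose]
  exact (Finset.sum_subset (by grind) fun m _ _ => Nat.choose_eq_zero_of_lt (by grind)).symm

theorem sum_hermiteH_sq_div (n : ℕ) :
    ∑ m ∈ Finset.range (n + 1), (1 / (2 ^ m * m !) : ℝ) • hermiteH m ^ 2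
      = ∑ j ∈ Finset.range (n + 1),
        ((n + 1).choose (j + 1) / (2 ^ j * j !) : ℝ) • hermiteH (2 * j) := by
  have hextend : ∀ m ∈ Finset.range (n + 1), (1 / (2 ^ m * m !) : ℝ) • hermiteH m ^ 2
      = ∑ j ∈ Finset.range (n + 1), (m.choose j / (2 ^ j * j !) : ℝ) • hermiteH (2 * j) := by
    intro m hm
    rw [hermiteH_sq_div]
    refine Finset.sum_subset (Finset.range_mono (by simpa using hm)) fun j _ hj => ?_
    rw [Nat.choose_eq_zero_of_lt (by simpa using hj), Nat.cast_zero, zero_div, zero_smul]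
  rw [Finset.sum_congr rfl hextend, Finset.sum_comm]
  refine Finset.sum_congr rfl fun j _ => ?_
  rw [← Finset.sum_smul, ← Finset.sum_div, ← Nat.cast_sum, sum_range_succ_choose]

/-! ### Gaussian integrals and Hermite functions -/

theorem integrable_gauss_mul_eval (p : ℝ[X]) :
    Integrable (fun x : ℝ => Real.exp (-x ^ 2) * p.eval x) := by
  induction p using Polynomial.induction_on' with
  | add p r hp hr => simpa only [eval_add, mul_add] using! hp.add hr
  | monomial n a =>
    have hn : (-1 : ℝ) < n := neg_one_lt_zero.trans_le n.cast_nonneg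
    refine ((integrable_rpow_mul_exp_neg_mul_sq one_pos hn).const_mul a).congr
      (Eventually.of_forall fun x => ?_)
    simp only [Real.rpow_natCast, neg_mul, one_mul, eval_monomial]
    ring

theorem exists_bound_gauss_mul_eval (p : ℝ[X]) :
    ∃ C, ∀ x : ℝ, |Real.exp (-x ^ 2) * p.eval x| ≤ C := by
  induction p using Polynomial.induction_on' with
  | add p r hp hr =>
    obtain ⟨C, hC⟩ := hp
    obtain ⟨D, hD⟩ := hr
    refine ⟨C + D, fun x => ?_⟩
    rw [eval_add, mul_add]
    exact (abs_add_le _ _).trans (add_le_add (hC x) (hD x))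
  | monomial n a =>
    refine ⟨|a| * (n ! * Real.exp 1), fun x => ?_⟩
    have hpow : |x| ^ n ≤ Real.exp |x| * n ! :=
      (div_le_iff₀ (by positivity)).1 (Real.pow_div_factorial_le_exp |x| (abs_nonneg x) n)
    have hexp : Real.exp (-x ^ 2) * Real.exp |x| ≤ Real.exp 1 := by
      rw [← Real.exp_add, Real.exp_le_exp]
      nlinarith [sq_abs x, sq_nonneg (|x| - 1)]
    rw [eval_monomial, abs_mul, abs_mul, abs_pow, Real.abs_exp]
    calc Real.exp (-x ^ 2) * (|a| * |x| ^ n)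
        ≤ Real.exp (-x ^ 2) * (|a| * (Real.exp |x| * n !)) := by gcongr
      _ = |a| * (n ! * (Real.exp (-x ^ 2) * Real.exp |x|)) := by ring
      _ ≤ _ := by gcongr

theorem integrable_gauss_mul_mul_eval {q : ℝ → ℝ} (hq : Integrable q) (p : ℝ[X]) :
    Integrable (fun x : ℝ => Real.exp (-x ^ 2) * q x * p.eval x) := by
  obtain ⟨C, hC⟩ := exists_bound_gauss_mul_eval p
  have hcont : Continuous (fun x : ℝ => Real.exp (-x ^ 2) * p.eval x) := by fun_prop
  simpa only [mul_right_comm] using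
    hq.bdd_mul hcont.aestronglyMeasurable (Eventually.of_forall hC)

/-- Integration of polynomials against a weight with finite moments. -/
noncomputable def weightedInt (w : ℝ → ℝ)
    (hw : ∀ p : ℝ[X], Integrable fun x => w x * p.eval x) : ℝ[X] →ₗ[ℝ] ℝ where
  toFun p := ∫ x, w x * p.eval x
  map_add' p r := by simp only [eval_add, mul_add, integral_add (hw p) (hw r)]
  map_smul' c p := by
    simp only [eval_smul, smul_eq_mul, mul_left_comm _ c, integral_const_mul, RingHom.id_apply]

theorem weightedInt_apply {w : ℝ → ℝ} (hw : ∀ p : ℝ[X], Integrable fun x => w x * p.eval x)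
    (p : ℝ[X]) : weightedInt w hw p = ∫ x, w x * p.eval x := rfl

/-- Integration of polynomials against the weight `e^{-x²}`. -/
noncomputable def gaussInt : ℝ[X] →ₗ[ℝ] ℝ :=
  weightedInt (fun x => Real.exp (-x ^ 2)) integrable_gauss_mul_eval

theorem gaussInt_apply (p : ℝ[X]) : gaussInt p = ∫ x : ℝ, Real.exp (-x ^ 2) * p.eval x := rfl

theorem gaussInt_one : gaussInt 1 = √Real.pi := by
  simpa [gaussInt_apply] using integral_gaussian 1

theorem hasDerivAt_gauss_mul_eval (p : ℝ[X]) (x : ℝ) :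
    HasDerivAt (fun x : ℝ => Real.exp (-x ^ 2) * p.eval x)
      (Real.exp (-x ^ 2) * (derivative p - 2 * X * p).eval x) x := by
  have hsq : HasDerivAt (fun x : ℝ => -x ^ 2) (-(2 * x)) x := by
    simpa using! (hasDerivAt_pow 2 x).neg
  refine (hsq.exp.mul (p.hasDerivAt x)).congr_deriv ?_
  simp only [eval_sub, eval_mul, eval_ofNat, eval_X]
  ring

theorem gaussInt_derivative (p : ℝ[X]) : gaussInt (derivative p) = gaussInt (2 * X * p) := by
  rw [← sub_eq_zero, ← map_sub]
  exact integral_eq_zero_of_hasDerivAt_of_integrable (hasDerivAt_gauss_mul_eval p)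
    (integrable_gauss_mul_eval _) (integrable_gauss_mul_eval _)

theorem gaussInt_hermiteH_succ_mul (k : ℕ) (p : ℝ[X]) :
    gaussInt (hermiteH (k + 1) * p) = gaussInt (hermiteH k * derivative p) := by
  have hparts := gaussInt_derivative (hermiteH k * p)
  rw [derivative_mul, map_add] at hparts
  have hraise : hermiteH (k + 1) * p
      = 2 * X * (hermiteH k * p) - derivative (hermiteH k) * p := by
    rw [hermiteH_succ]
    ring
  rw [hraise, map_sub, ← hparts, add_sub_cancel_left]

/-- The squared norm `√π 2^k k!` of `H_k` for the weight `e^{-x²}`. -/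
noncomputable def hermiteNormSq (k : ℕ) : ℝ := √Real.pi * 2 ^ k * k !

theorem hermiteNormSq_pos (k : ℕ) : 0 < hermiteNormSq k := by
  rw [hermiteNormSq]
  positivity

theorem hermiteNormSq_succ (k : ℕ) : hermiteNormSq (k + 1) = 2 * (k + 1) * hermiteNormSq k := by
  rw [hermiteNormSq, hermiteNormSq, Nat.factorial_succ]
  push_cast
  ring

theorem gaussInt_hermiteH_mul_hermiteH (m n : ℕ) :
    gaussInt (hermiteH m * hermiteH n) = if m = n then hermiteNormSq n else 0 := by
  induction m generalizing n with
  | zero =>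
    cases n with
    | zero => simp [hermiteH, gaussInt_one, hermiteNormSq]
    | succ n =>
      rw [mul_comm, gaussInt_hermiteH_succ_mul]
      simp [hermiteH]
  | succ m ih =>
    rw [gaussInt_hermiteH_succ_mul]
    cases n with
    | zero => simp [hermiteH]
    | succ n =>
      rw [derivative_hermiteH_succ, mul_smul_comm, map_smul, ih, hermiteNormSq_succ]
      simp

theorem gaussInt_derivative_hermiteH_sq (k : ℕ) :
    gaussInt (derivative (hermiteH k) ^ 2) = 2 * k * hermiteNormSq k := by
  cases k with
  | zero => simp [hermiteH]
  | succ k =>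
    rw [sq]
    nth_rewrite 1 [derivative_hermiteH_succ]
    rw [smul_mul_assoc, map_smul, ← gaussInt_hermiteH_succ_mul, gaussInt_hermiteH_mul_hermiteH,
      if_pos rfl, smul_eq_mul, Nat.cast_succ]

/-- The `L²`-normalized Hermite functions `h_k`. -/
noncomputable def hermiteFn (k : ℕ) (x : ℝ) : ℝ :=
  (√(hermiteNormSq k))⁻¹ * (Real.exp (-x ^ 2 / 2) * (hermiteH k).eval x)

/-- The derivatives of the Hermite functions. -/
noncomputable def hermiteFnDeriv (k : ℕ) (x : ℝ) : ℝ :=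
  (√(hermiteNormSq k))⁻¹ *
    (Real.exp (-x ^ 2 / 2) * (derivative (hermiteH k) - X * hermiteH k).eval x)

theorem hasDerivAt_hermiteFn (k : ℕ) (x : ℝ) :
    HasDerivAt (hermiteFn k) (hermiteFnDeriv k x) x := by
  have hsq : HasDerivAt (fun x : ℝ => -x ^ 2 / 2) (-x) x := by
    refine ((hasDerivAt_pow 2 x).neg.div_const 2).congr_deriv ?_
    push_cast
    ring
  refine ((hsq.exp.mul ((hermiteH k).hasDerivAt x)).const_mul _).congr_deriv ?_
  simp only [hermiteFnDeriv, eval_sub, eval_mul, eval_X]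
  ring

theorem exp_half_sq (x : ℝ) : Real.exp (-x ^ 2 / 2) ^ 2 = Real.exp (-x ^ 2) := by
  rw [← Real.exp_nat_mul]
  congr 1
  push_cast
  ring

theorem memLp_exp_half_mul_eval (p : ℝ[X]) :
    MemLp (fun x : ℝ => Real.exp (-x ^ 2 / 2) * p.eval x) 2 := by
  have hcont : Continuous (fun x : ℝ => Real.exp (-x ^ 2 / 2) * p.eval x) := by fun_prop
  rw [memLp_two_iff_integrable_sq hcont.aestronglyMeasurable]
  simpa only [mul_pow, exp_half_sq, eval_pow] using integrable_gauss_mul_eval (p ^ (2 : ℕ))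

theorem inv_sqrt_hermiteNormSq_sq (k : ℕ) : (√(hermiteNormSq k))⁻¹ ^ 2 = (hermiteNormSq k)⁻¹ := by
  rw [inv_pow, Real.sq_sqrt (hermiteNormSq_pos k).le]

theorem integral_hermiteFn_mul (m n : ℕ) :
    ∫ x, hermiteFn m x * hermiteFn n x = if m = n then 1 else 0 := by
  have hprod : ∀ x, hermiteFn m x * hermiteFn n x
      = ((√(hermiteNormSq m))⁻¹ * (√(hermiteNormSq n))⁻¹) *
        (Real.exp (-x ^ 2) * (hermiteH m * hermiteH n).eval x) := by
    intro x
    rw [hermiteFn, hermiteFn, eval_mul, ← exp_half_sq]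
    ring
  simp_rw [hprod, integral_const_mul, ← gaussInt_apply, gaussInt_hermiteH_mul_hermiteH]
  split_ifs with h
  · rw [h, ← sq, inv_sqrt_hermiteNormSq_sq, inv_mul_cancel₀ (hermiteNormSq_pos n).ne']
  · rw [mul_zero]

theorem integral_hermiteFn_energy (k : ℕ) :
    ∫ x, (hermiteFnDeriv k x ^ 2 + x ^ 2 * hermiteFn k x ^ 2) = harmonicEigenvalue k := by
  -- `H_k' - x H_k = (H_k' - H_{k+1}) / 2` and `x H_k = (H_k' + H_{k+1}) / 2`
  have henergy : ∀ x, hermiteFnDeriv k x ^ 2 + x ^ 2 * hermiteFn k x ^ 2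
      = (hermiteNormSq k)⁻¹ * (Real.exp (-x ^ 2) *
        ((1 / 2 : ℝ) • (derivative (hermiteH k) ^ 2
          + hermiteH (k + 1) * hermiteH (k + 1))).eval x) := by
    intro x
    rw [hermiteFnDeriv, hermiteFn, ← exp_half_sq, ← inv_sqrt_hermiteNormSq_sq, hermiteH_succ]
    simp only [eval_sub, eval_mul, eval_add, eval_smul, eval_pow, eval_X, eval_ofNat, smul_eq_mul]
    ring
  simp_rw [henergy, integral_const_mul, ← gaussInt_apply, map_smul, map_add,
    gaussInt_derivative_hermiteH_sq, gaussInt_hermiteH_mul_hermiteH, if_pos, hermiteNormSq_succ,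
    smul_eq_mul]
  rw [inv_mul_eq_iff_eq_mul₀ (hermiteNormSq_pos k).ne', harmonicEigenvalue]
  ring

theorem mul_hermiteFn_sq (q : ℝ → ℝ) (k : ℕ) (x : ℝ) :
    q x * hermiteFn k x ^ 2 = (√Real.pi)⁻¹ * (Real.exp (-x ^ 2) * q x *
      ((1 / (2 ^ k * k !) : ℝ) • hermiteH k ^ 2).eval x) := by
  rw [hermiteFn, mul_pow, mul_pow, inv_sqrt_hermiteNormSq_sq, exp_half_sq, hermiteNormSq,
    eval_smul, eval_pow, smul_eq_mul]
  field_simp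

theorem sum_integral_mul_hermiteFn_sq {q : ℝ → ℝ} (hq : Integrable q) (n : ℕ) :
    ∑ k ∈ Finset.range (n + 1), ∫ x, q x * hermiteFn k x ^ 2
      = ∑ k ∈ Finset.range (n + 1), (2 : ℝ) ^ k * ((2 * k)! : ℝ) / (k ! : ℝ)
        * ((n + 1).choose (k + 1) : ℝ) * hermiteCoeff q (2 * k) := by
  have hq' := integrable_gauss_mul_mul_eval hq
  simp_rw [mul_hermiteFn_sq, integral_const_mul, ← weightedInt_apply hq', ← Finset.mul_sum,
    ← map_sum, sum_hermiteH_sq_div, map_sum, map_smul, Finset.mul_sum]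
  refine Finset.sum_congr rfl fun k _ => ?_
  rw [weightedInt_apply, hermiteCoeff, smul_eq_mul, pow_mul']
  field_simp

/-! ### Weak derivatives -/

/-- `F` is locally absolutely continuous with derivative `g`, encoded by the fundamental theorem of
calculus: `F` is an indefinite integral of the locally integrable function `g`. -/
structure HasWeakDeriv (F g : ℝ → ℝ) : Prop where
  intervalIntegrable : ∀ a b : ℝ, IntervalIntegrable g volume a b
  integral_eq : ∀ a b : ℝ, ∫ t in a..b, g t = F b - F a

namespace HasWeakDeriv

variable {F G g h : ℝ → ℝ}

theorem of_primitive (hg : ∀ a b : ℝ, IntervalIntegrable g volume a b) {c x₀ : ℝ}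
    (hF : ∀ x, F x = c + ∫ t in x₀..x, g t) : HasWeakDeriv F g :=
  ⟨hg, fun a b => by
    rw [hF a, hF b, ← intervalIntegral.integral_interval_sub_left (hg x₀ b) (hg x₀ a)]
    ring⟩

theorem of_hasDerivAt (hF : ∀ x, HasDerivAt F (g x) x) (hg : Continuous g) : HasWeakDeriv F g :=
  ⟨fun a b => hg.intervalIntegrable a b, fun a b =>
    intervalIntegral.integral_eq_sub_of_hasDerivAt (fun x _ => hF x) (hg.intervalIntegrable a b)⟩

theorem of_contDiff (hF : ContDiff ℝ 1 F) : HasWeakDeriv F (deriv F) :=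
  of_hasDerivAt (fun x => (hF.differentiable one_ne_zero x).hasDerivAt) (hF.continuous_deriv le_rfl)

theorem of_absolutelyContinuousOnInterval (hF : ∀ a b, AbsolutelyContinuousOnInterval F a b) :
    HasWeakDeriv F (deriv F) :=
  ⟨fun a b => (hF a b).intervalIntegrable_deriv, fun a b => (hF a b).integral_deriv_eq_sub⟩

theorem congr_ae (hF : HasWeakDeriv F g) (hgh : g =ᵐ[volume] h) : HasWeakDeriv F h :=
  ⟨fun a b => (hF.intervalIntegrable a b).congr_ae (ae_restrict_of_ae hgh), fun a b => by
    rw [← hF.integral_eq]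
    exact intervalIntegral.integral_congr_ae (hgh.mono fun x hx _ => hx.symm)⟩

theorem eq_add (hF : HasWeakDeriv F g) (a x : ℝ) : F x = F a + ∫ t in a..x, g t := by
  rw [hF.integral_eq, add_sub_cancel]

theorem funext_eq_add (hF : HasWeakDeriv F g) (a : ℝ) : F = fun x => F a + ∫ t in a..x, g t :=
  funext (hF.eq_add a)

theorem continuous (hF : HasWeakDeriv F g) : Continuous F := by
  rw [hF.funext_eq_add 0]
  exact continuous_const.add (intervalIntegral.continuous_primitive hF.intervalIntegrable 0)

theorem hasDerivAt (hF : HasWeakDeriv F g) (hg : Continuous g) (x : ℝ) : HasDerivAt F (g x) x := by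
  rw [hF.funext_eq_add 0]
  exact (intervalIntegral.integral_hasDerivAt_right (hg.intervalIntegrable _ _)
    (hg.stronglyMeasurableAtFilter _ _) hg.continuousAt).const_add _

theorem locallyIntegrable (hF : HasWeakDeriv F g) : LocallyIntegrable g := fun x =>
  ⟨Set.Ioo (x - 1) (x + 1), Ioo_mem_nhds (by linarith) (by linarith),
    (hF.intervalIntegrable (x - 1) (x + 1)).1.mono_set Set.Ioo_subset_Ioc_self⟩

theorem ae_hasDerivAt (hF : HasWeakDeriv F g) : ∀ᵐ x, HasDerivAt F (g x) x := by
  filter_upwards [LocallyIntegrable.ae_hasDerivAt_integral hF.locallyIntegrable] with x hx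
  rw [hF.funext_eq_add 0]
  exact (hx 0).const_add (F 0)

theorem absolutelyContinuousOnInterval (hF : HasWeakDeriv F g) (a b : ℝ) :
    AbsolutelyContinuousOnInterval F a b := by
  rw [hF.funext_eq_add a]
  exact contDiffOn_const.absolutelyContinuousOnInterval.add
    ((hF.intervalIntegrable a b).absolutelyContinuousOnInterval_intervalIntegral (by simp))

theorem mul (hF : HasWeakDeriv F g) (hG : HasWeakDeriv G h) :
    HasWeakDeriv (fun x => F x * G x) (fun x => g x * G x + F x * h x) := by
  refine (of_absolutelyContinuousOnInterval fun a b =>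
    (hF.absolutelyContinuousOnInterval a b).fun_mul
      (hG.absolutelyContinuousOnInterval a b)).congr_ae ?_
  filter_upwards [hF.ae_hasDerivAt, hG.ae_hasDerivAt] with x hFx hGx
  exact (hFx.mul hGx).deriv

theorem integral_eq_zero (hF : HasWeakDeriv F g) (hFi : Integrable F) (hgi : Integrable g) :
    ∫ x, g x = 0 := by
  have hTop : F 0 + ∫ t in Set.Ioi 0, g t = 0 := by
    have hlim := intervalIntegral_tendsto_integral_Ioi 0 hgi.integrableOn tendsto_id
    refine (hFi.integrableAtFilter atTop).eq_zero_of_tendsto (fun s hs => ?_)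
      ((hlim.const_add (F 0)).congr fun x => (hF.eq_add 0 x).symm)
    obtain ⟨b, hb⟩ := mem_atTop_sets.1 hs
    exact top_unique (Real.volume_Ici.symm.le.trans (measure_mono hb))
  have hBot : F 0 - ∫ t in Set.Iic 0, g t = 0 := by
    have hlim := intervalIntegral_tendsto_integral_Iic 0 hgi.integrableOn tendsto_id
    refine (hFi.integrableAtFilter atBot).eq_zero_of_tendsto (fun s hs => ?_)
      ((hlim.const_sub (F 0)).congr fun x => by rw [hF.integral_eq, sub_sub_cancel, id])
    obtain ⟨b, hb⟩ := mem_atBot_sets.1 hs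
    exact top_unique (Real.volume_Iic.symm.le.trans (measure_mono hb))
  rw [← intervalIntegral.integral_Iic_add_Ioi (b := 0) hgi.integrableOn hgi.integrableOn]
  linarith

end HasWeakDeriv

/-! ### The form domain of the harmonic oscillator -/

section FormDomain

open scoped InnerProductSpace

theorem intervalIntegrable_of_memLp_two {v : ℝ → ℝ} (hv : MemLp v 2) (a b : ℝ) :
    IntervalIntegrable v volume a b :=
  ((hv.locallyIntegrable one_le_two).integrableOn_isCompact isCompact_uIcc).intervalIntegrable

theorem one_le_sqrt_one_add_sq (x : ℝ) : 1 ≤ √(1 + x ^ 2) :=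
  Real.one_le_sqrt.2 (le_add_of_nonneg_right (sq_nonneg x))

/-- The real Hilbert space `L²(ℝ)`. -/
abbrev RealL2 : Type := Lp ℝ 2 (volume : Measure ℝ)

namespace RealL2

theorem inner_eq (v w : RealL2) : ⟪v, w⟫_ℝ = ∫ x, v x * w x := by
  simp only [L2.inner_def, RCLike.inner_apply, conj_trivial, mul_comm]

theorem norm_sq (v : RealL2) : ‖v‖ ^ 2 = ∫ x, v x ^ 2 := by
  rw [← real_inner_self_eq_norm_sq, inner_eq]
  simp only [sq]

theorem intervalIntegrable (v : RealL2) (a b : ℝ) : IntervalIntegrable v volume a b :=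
  intervalIntegrable_of_memLp_two (Lp.memLp v) a b

/-- The `L²` function `1_(a, b]`, equal to `0` when `b ≤ a`. -/
noncomputable def indicatorIoc (a b : ℝ) : RealL2 :=
  indicatorConstLp 2 measurableSet_Ioc (measure_Ioc_lt_top (a := a) (b := b)).ne 1

theorem coeFn_indicatorIoc (a b : ℝ) :
    indicatorIoc a b =ᵐ[volume] (Set.Ioc a b).indicator fun _ => (1 : ℝ) :=
  indicatorConstLp_coeFn

theorem inner_indicatorIoc (a b : ℝ) (v : RealL2) :
    ⟪indicatorIoc a b, v⟫_ℝ = ∫ x in Set.Ioc a b, v x :=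
  L2.inner_indicatorConstLp_one _ _ _

theorem norm_indicatorIoc_sq {a b : ℝ} (hab : a ≤ b) : ‖indicatorIoc a b‖ ^ 2 = b - a := by
  have hone : ∀ᵐ x, x ∈ Set.Ioc a b → indicatorIoc a b x = 1 :=
    (coeFn_indicatorIoc a b).mono fun x hx hxs => by rw [hx, Set.indicator_of_mem hxs]
  rw [← real_inner_self_eq_norm_sq, inner_indicatorIoc,
    setIntegral_congr_ae measurableSet_Ioc hone]
  simp [hab]

theorem sq_intervalIntegral_le (v : RealL2) (a b : ℝ) :
    (∫ x in a..b, v x) ^ 2 ≤ |b - a| * ‖v‖ ^ 2 := by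
  wlog hab : a ≤ b generalizing a b
  · rw [intervalIntegral.integral_symm, neg_sq, abs_sub_comm]
    exact this b a (le_of_not_ge hab)
  rw [abs_of_nonneg (sub_nonneg.2 hab), ← norm_indicatorIoc_sq hab, ← mul_pow,
    intervalIntegral.integral_of_le hab, ← inner_indicatorIoc]
  exact sq_le_sq.2 ((abs_real_inner_le_norm _ _).trans (le_abs_self _))

/-- The primitive at `x` of an `L²` function, as a continuous functional. -/
noncomputable def primitive (x : ℝ) : RealL2 →L[ℝ] ℝ :=
  innerSL ℝ (indicatorIoc 0 x) - innerSL ℝ (indicatorIoc x 0)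

theorem primitive_apply (x : ℝ) (v : RealL2) : primitive x v = ∫ t in (0 : ℝ)..x, v t :=
  congrArg₂ (· - ·) (inner_indicatorIoc 0 x v) (inner_indicatorIoc x 0 v)

end RealL2

/-- The ambient Hilbert space `ℝ × L² × L²` of the form domain: an element records `u 0`, `u'` and
`√(1 + x²) u`. -/
abbrev FormAmbient : Type := WithLp 2 (ℝ × WithLp 2 (RealL2 × RealL2))

/-- The function with value `e.1` at `0` and derivative `e.2.1`, evaluated at `x`. -/
noncomputable def FormAmbient.eval (x : ℝ) : FormAmbient →L[ℝ] ℝ :=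
  WithLp.fstL 2 ℝ ℝ (WithLp 2 (RealL2 × RealL2)) +
    RealL2.primitive x ∘L WithLp.fstL 2 ℝ RealL2 RealL2 ∘L
      WithLp.sndL 2 ℝ ℝ (WithLp 2 (RealL2 × RealL2))

theorem FormAmbient.eval_apply (x : ℝ) (e : FormAmbient) :
    FormAmbient.eval x e = e.fst + ∫ t in (0 : ℝ)..x, e.snd.fst t :=
  congrArg (e.fst + ·) (RealL2.primitive_apply x e.snd.fst)

/-- The form domain of the harmonic oscillator, the functions `u` with `u'` and `√(1 + x²) u` in
`L²`, as a subspace of `ℝ × L² × L²`. -/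
noncomputable def formSubmodule : Submodule ℝ FormAmbient where
  carrier := {e | (e.snd.snd : ℝ → ℝ) =ᵐ[volume] fun x => √(1 + x ^ 2) * FormAmbient.eval x e}
  zero_mem' := by
    filter_upwards [Lp.coeFn_zero ℝ 2 (volume : Measure ℝ)] with x hx
    rw [map_zero, mul_zero]
    exact hx
  add_mem' := by
    intro e f he hf
    filter_upwards [he, hf, Lp.coeFn_add e.snd.snd f.snd.snd] with x hex hfx hadd
    rw [map_add, mul_add, ← hex, ← hfx]
    exact hadd
  smul_mem' := by
    intro c e he
    filter_upwards [he, Lp.coeFn_smul c e.snd.snd] with x hex hsmul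
    rw [map_smul, smul_eq_mul, mul_left_comm, ← hex]
    exact hsmul

theorem isClosed_formSubmodule : IsClosed (formSubmodule : Set FormAmbient) := by
  rw [← isSeqClosed_iff_isClosed]
  intro e f he hlim
  have hsnd : Tendsto (fun n => (e n).snd.snd) atTop (nhds f.snd.snd) :=
    ((WithLp.sndL 2 ℝ RealL2 RealL2 ∘L
      WithLp.sndL 2 ℝ ℝ (WithLp 2 (RealL2 × RealL2))).continuous.tendsto f).comp hlim
  obtain ⟨ns, hns, hae⟩ := (tendstoInMeasure_of_tendsto_Lp hsnd).exists_seq_tendsto_ae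
  have hmem : ∀ᵐ x : ℝ, ∀ n, (e n).snd.snd x = √(1 + x ^ 2) * FormAmbient.eval x (e n) :=
    ae_all_iff.2 he
  change (f.snd.snd : ℝ → ℝ) =ᵐ[volume] fun x => √(1 + x ^ 2) * FormAmbient.eval x f
  filter_upwards [hae, hmem] with x hx hmemx
  refine tendsto_nhds_unique hx ?_
  simp_rw [hmemx]
  exact (((FormAmbient.eval x).continuous.tendsto f).comp
    (hlim.comp hns.tendsto_atTop)).const_mul _

/-- The form domain of the harmonic oscillator as a Hilbert space. -/
def FormDomain : Type := formSubmodule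

namespace FormDomain

noncomputable instance : NormedAddCommGroup FormDomain :=
  inferInstanceAs (NormedAddCommGroup formSubmodule)

noncomputable instance : InnerProductSpace ℝ FormDomain :=
  inferInstanceAs (InnerProductSpace ℝ formSubmodule)

instance : CompleteSpace FormDomain := isClosed_formSubmodule.completeSpace_coe

/-- The inclusion into the ambient space. -/
noncomputable def val : FormDomain →L[ℝ] FormAmbient := formSubmodule.subtypeL

/-- Evaluation at a point, a continuous functional on the form domain. -/
noncomputable def evalL (x : ℝ) : FormDomain →L[ℝ] ℝ := FormAmbient.eval x ∘L val

/-- The continuous function represented by an element of the form domain. -/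
noncomputable def fn (e : FormDomain) (x : ℝ) : ℝ := evalL x e

/-- The weak derivative. -/
noncomputable def der : FormDomain →L[ℝ] RealL2 :=
  WithLp.fstL 2 ℝ RealL2 RealL2 ∘L WithLp.sndL 2 ℝ ℝ (WithLp 2 (RealL2 × RealL2)) ∘L val

/-- Multiplication by the weight `√(1 + x²)`. -/
noncomputable def wgt : FormDomain →L[ℝ] RealL2 :=
  WithLp.sndL 2 ℝ RealL2 RealL2 ∘L WithLp.sndL 2 ℝ ℝ (WithLp 2 (RealL2 × RealL2)) ∘L val

theorem fn_add (e f : FormDomain) (x : ℝ) : fn (e + f) x = fn e x + fn f x := map_add _ _ _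

theorem fn_smul (c : ℝ) (e : FormDomain) (x : ℝ) : fn (c • e) x = c * fn e x := map_smul _ _ _

theorem fn_eq_add (e : FormDomain) (x : ℝ) :
    fn e x = (val e).fst + ∫ t in (0 : ℝ)..x, der e t :=
  FormAmbient.eval_apply x (val e)

theorem hasWeakDeriv (e : FormDomain) : HasWeakDeriv (fn e) (der e) :=
  .of_primitive (der e).intervalIntegrable (fn_eq_add e)

theorem continuous_fn (e : FormDomain) : Continuous (fn e) := e.hasWeakDeriv.continuous

theorem coeFn_wgt (e : FormDomain) : wgt e =ᵐ[volume] fun x => √(1 + x ^ 2) * fn e x :=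
  Subtype.property (p := (· ∈ formSubmodule)) e

theorem norm_sq_eq (e : FormDomain) : ‖e‖ ^ 2 = fn e 0 ^ 2 + (‖der e‖ ^ 2 + ‖wgt e‖ ^ 2) := by
  have hzero : fn e 0 = (val e).fst := by rw [fn_eq_add, intervalIntegral.integral_same, add_zero]
  rw [hzero, ← sq_abs (val e).fst, ← Real.norm_eq_abs]
  exact (WithLp.prod_norm_sq_eq_of_L2 (val e)).trans
    (congrArg _ (WithLp.prod_norm_sq_eq_of_L2 (val e).snd))

theorem fn_injective : Function.Injective fn := fun e f hfn => by
  have hder : der e = der f := by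
    refine Lp.ext ?_
    filter_upwards [e.hasWeakDeriv.ae_hasDerivAt, f.hasWeakDeriv.ae_hasDerivAt] with x hex hfx
    exact hex.unique (hfn ▸ hfx)
  have hwgt : wgt e = wgt f := by
    refine Lp.ext ?_
    filter_upwards [coeFn_wgt e, coeFn_wgt f] with x hex hfx
    rw [hex, hfx, hfn]
  have hzero : fn (e - f) 0 = 0 := (map_sub _ _ _).trans (sub_eq_zero.2 (congrFun hfn 0))
  have hnorm : ‖e - f‖ ^ 2 = 0 := by
    simp [norm_sq_eq, hzero, hder, hwgt]
  exact sub_eq_zero.1 (norm_eq_zero.1 (pow_eq_zero_iff two_ne_zero |>.1 hnorm))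

theorem norm_der_le (e : FormDomain) : ‖der e‖ ≤ ‖e‖ :=
  le_of_sq_le_sq (by linarith [norm_sq_eq e, sq_nonneg (fn e 0), sq_nonneg ‖wgt e‖])
    (norm_nonneg e)

theorem norm_wgt_le (e : FormDomain) : ‖wgt e‖ ≤ ‖e‖ :=
  le_of_sq_le_sq (by linarith [norm_sq_eq e, sq_nonneg (fn e 0), sq_nonneg ‖der e‖])
    (norm_nonneg e)

theorem ae_norm_fn_le (e : FormDomain) : ∀ᵐ x, ‖fn e x‖ ≤ ‖wgt e x‖ := by
  filter_upwards [coeFn_wgt e] with x hx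
  rw [hx, norm_mul, Real.norm_eq_abs √_, abs_of_nonneg (Real.sqrt_nonneg _)]
  exact le_mul_of_one_le_left (norm_nonneg _) (one_le_sqrt_one_add_sq x)

theorem memLp_fn (e : FormDomain) : MemLp (fn e) 2 :=
  (Lp.memLp (wgt e)).of_le (continuous_fn e).aestronglyMeasurable (ae_norm_fn_le e)

theorem norm_toLp_fn_le (e : FormDomain) : ‖(memLp_fn e).toLp (fn e)‖ ≤ ‖wgt e‖ := by
  refine Lp.norm_le_norm_of_ae_le ?_
  filter_upwards [(memLp_fn e).coeFn_toLp, ae_norm_fn_le e] with x hx hle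
  rwa [hx]

/-- The embedding of the form domain into `L²`. -/
noncomputable def emb : FormDomain →L[ℝ] RealL2 :=
  LinearMap.mkContinuous
    { toFun := fun e => (memLp_fn e).toLp (fn e)
      map_add' := fun e f => by
        simp only [← MemLp.toLp_add, funext (fn_add e f), ← Pi.add_def]
      map_smul' := fun c e => by
        simp only [RingHom.id_apply, ← MemLp.toLp_const_smul, funext (fn_smul c e), Pi.smul_def,
          smul_eq_mul] }
    1 (fun e => by
      rw [one_mul]
      exact (norm_toLp_fn_le e).trans (norm_wgt_le e))

theorem coeFn_emb (e : FormDomain) : emb e =ᵐ[volume] fn e := (memLp_fn e).coeFn_toLp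

theorem norm_emb_le_norm_wgt (e : FormDomain) : ‖emb e‖ ≤ ‖wgt e‖ := norm_toLp_fn_le e

theorem inner_emb (v : RealL2) (e : FormDomain) : ⟪v, emb e⟫_ℝ = ∫ x, v x * fn e x := by
  rw [RealL2.inner_eq]
  exact integral_congr_ae ((coeFn_emb e).mono fun x hx => by simp only [hx])

theorem inner_emb_emb (e f : FormDomain) : ⟪emb e, emb f⟫_ℝ = ∫ x, fn e x * fn f x := by
  rw [inner_emb]
  exact integral_congr_ae ((coeFn_emb e).mono fun x hx => by simp only [hx])

theorem norm_emb_sq (e : FormDomain) : ‖emb e‖ ^ 2 = ∫ x, fn e x ^ 2 := by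
  rw [← real_inner_self_eq_norm_sq, inner_emb_emb]
  simp only [sq]

theorem sq_fn_sub_fn_le (e : FormDomain) (x y : ℝ) :
    (fn e y - fn e x) ^ 2 ≤ |y - x| * ‖der e‖ ^ 2 := by
  rw [← e.hasWeakDeriv.integral_eq]
  exact (der e).sq_intervalIntegral_le x y

/-- The Sobolev inequality with a small constant in front of the derivative, obtained by averaging
`|u x|² ≤ 2 |u y|² + 2 |u x - u y|²` over `y ∈ [x, x + δ]`. -/
theorem fn_sq_le (e : FormDomain) {δ : ℝ} (hδ : 0 < δ) (x : ℝ) :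
    fn e x ^ 2 ≤ 2 / δ * ‖emb e‖ ^ 2 + 2 * δ * ‖der e‖ ^ 2 := by
  have hcont : Continuous fun y => 2 * fn e y ^ 2 := by
    have := continuous_fn e
    fun_prop
  have hpoint : ∀ y ∈ Set.Icc x (x + δ), fn e x ^ 2 ≤ 2 * fn e y ^ 2 + 2 * δ * ‖der e‖ ^ 2 := by
    intro y hy
    have hdist : |y - x| * ‖der e‖ ^ 2 ≤ δ * ‖der e‖ ^ 2 := by
      gcongr
      rw [abs_of_nonneg (sub_nonneg.2 hy.1)]
      exact sub_le_iff_le_add'.2 hy.2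
    nlinarith [sq_nonneg (2 * fn e y - fn e x), sq_fn_sub_fn_le e x y]
  have havg := intervalIntegral.integral_mono_on (μ := volume) (le_add_of_nonneg_right hδ.le)
    intervalIntegrable_const ((hcont.intervalIntegrable _ _).add intervalIntegrable_const) hpoint
  have hlocal : ∫ y in x..(x + δ), fn e y ^ 2 ≤ ‖emb e‖ ^ 2 := by
    rw [norm_emb_sq, intervalIntegral.integral_of_le (le_add_of_nonneg_right hδ.le)]
    exact setIntegral_le_integral (memLp_fn e).integrable_sq
      (Eventually.of_forall fun y => sq_nonneg _)
  rw [intervalIntegral.integral_add (hcont.intervalIntegrable _ _) intervalIntegrable_const,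
    intervalIntegral.integral_const_mul, intervalIntegral.integral_const,
    intervalIntegral.integral_const, smul_eq_mul, smul_eq_mul, add_sub_cancel_left] at havg
  rw [← mul_le_mul_iff_right₀ hδ]
  calc δ * fn e x ^ 2 ≤ 2 * ‖emb e‖ ^ 2 + δ * (2 * δ * ‖der e‖ ^ 2) := by linarith
    _ = δ * (2 / δ * ‖emb e‖ ^ 2 + 2 * δ * ‖der e‖ ^ 2) := by field_simp

theorem fn_sq_le_norm_der_wgt (e : FormDomain) (x : ℝ) :
    fn e x ^ 2 ≤ 2 * (‖der e‖ ^ 2 + ‖wgt e‖ ^ 2) := by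
  linarith [fn_sq_le e one_pos x,
    pow_le_pow_left₀ (norm_nonneg _) (norm_emb_le_norm_wgt e) 2]

theorem norm_sq_le (e : FormDomain) : ‖e‖ ^ 2 ≤ 3 * (‖der e‖ ^ 2 + ‖wgt e‖ ^ 2) := by
  linarith [norm_sq_eq e, fn_sq_le_norm_der_wgt e 0]

theorem abs_fn_le (e : FormDomain) (x : ℝ) : |fn e x| ≤ 2 * ‖e‖ := by
  refine abs_le_of_sq_le_sq ?_ (by positivity)
  linarith [fn_sq_le_norm_der_wgt e x, norm_sq_eq e, sq_nonneg (fn e 0), sq_nonneg ‖e‖]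

end FormDomain

namespace HasWeakDeriv

open FormDomain

variable {u v : ℝ → ℝ}

theorem exists_formDomain (h : HasWeakDeriv u v) (hv : MemLp v 2)
    (hw : MemLp (fun x => √(1 + x ^ 2) * u x) 2) :
    ∃ e : FormDomain, fn e = u ∧ der e =ᵐ[volume] v := by
  let a : FormAmbient := WithLp.toLp 2 (u 0, WithLp.toLp 2 (hv.toLp v, hw.toLp _))
  have heval : ∀ x, FormAmbient.eval x a = u x := fun x => by
    rw [FormAmbient.eval_apply, h.eq_add 0 x]
    congr 1
    exact intervalIntegral.integral_congr_ae (hv.coeFn_toLp.mono fun t ht _ => ht)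
  have ha : a ∈ formSubmodule := by
    change (hw.toLp _ : RealL2) =ᵐ[volume] fun x => √(1 + x ^ 2) * FormAmbient.eval x a
    simp_rw [heval]
    exact hw.coeFn_toLp
  exact ⟨⟨a, ha⟩, funext heval, hv.coeFn_toLp⟩

theorem exists_formDomain_of_hasCompactSupport (h : HasWeakDeriv u v) (hv : MemLp v 2)
    (hu : HasCompactSupport u) : ∃ e : FormDomain, fn e = u ∧ der e =ᵐ[volume] v := by
  refine h.exists_formDomain hv (Continuous.memLp_of_hasCompactSupport ?_ hu.mul_left)
  have := h.continuous
  fun_prop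

end HasWeakDeriv

end FormDomain

section Compactness

namespace FormDomain

/-- The `i`-th point of the grid of mesh `1 / N ^ 2` starting at `-N`. -/
noncomputable def gridPt (N i : ℕ) : ℝ := -N + i / N ^ 2

theorem monotone_gridPt (N : ℕ) : Monotone (gridPt N) := fun i j hij => by
  unfold gridPt
  gcongr

theorem gridPt_succ_sub (N i : ℕ) : gridPt N (i + 1) - gridPt N i = 1 / N ^ 2 := by
  rw [gridPt, gridPt, Nat.cast_succ]
  ring

theorem gridPt_zero (N : ℕ) : gridPt N 0 = -N := by
  rw [gridPt, Nat.cast_zero, zero_div, add_zero]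

theorem gridPt_last {N : ℕ} (hN : 0 < N) : gridPt N (2 * N ^ 3) = N := by
  rw [gridPt]
  field_simp
  push_cast
  ring

/-- Approximation by step functions on a grid, an operator of finite rank. -/
noncomputable def stepApprox (N : ℕ) : FormDomain →L[ℝ] RealL2 :=
  ∑ i ∈ Finset.range (2 * N ^ 3),
    (evalL (gridPt N i)).smulRight (RealL2.indicatorIoc (gridPt N i) (gridPt N (i + 1)))

theorem isCompactOperator_stepApprox (N : ℕ) : IsCompactOperator (stepApprox N) :=
  Submodule.sum_mem (compactOperator (RingHom.id ℝ) FormDomain RealL2) fun i _ =>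
    (isCompactOperator_of_locallyCompactSpace_rng
      (ContinuousLinearMap.toSpanSingleton ℝ _)).comp_clm (evalL (gridPt N i))

theorem coeFn_stepApprox (N : ℕ) (e : FormDomain) :
    ∀ᵐ x, stepApprox N e x = ∑ i ∈ Finset.range (2 * N ^ 3),
      (Set.Ioc (gridPt N i) (gridPt N (i + 1))).indicator (fun _ => fn e (gridPt N i)) x := by
  have hcell : ∀ i, (fn e (gridPt N i) • RealL2.indicatorIoc (gridPt N i) (gridPt N (i + 1)) :
      RealL2) =ᵐ[volume]
        (Set.Ioc (gridPt N i) (gridPt N (i + 1))).indicator fun _ => fn e (gridPt N i) := by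
    intro i
    filter_upwards [Lp.coeFn_smul (fn e (gridPt N i))
      (RealL2.indicatorIoc (gridPt N i) (gridPt N (i + 1))),
      RealL2.coeFn_indicatorIoc (gridPt N i) (gridPt N (i + 1))] with x hsmul hind
    rw [hsmul, Pi.smul_apply, hind, ← Set.indicator_const_smul_apply, smul_eq_mul, mul_one]
  have happly : stepApprox N e = ∑ i ∈ Finset.range (2 * N ^ 3),
      fn e (gridPt N i) • RealL2.indicatorIoc (gridPt N i) (gridPt N (i + 1)) := by
    simp only [stepApprox, sum_apply, ContinuousLinearMap.smulRight_apply, fn]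
  rw [happly]
  filter_upwards [Lp.coeFn_finsetSum (Finset.range (2 * N ^ 3)) fun i =>
    fn e (gridPt N i) • RealL2.indicatorIoc (gridPt N i) (gridPt N (i + 1)),
    ae_all_iff.2 hcell] with x hsum hx
  rw [hsum, Finset.sum_apply]
  exact Finset.sum_congr rfl fun i _ => hx i

theorem sum_indicator_Ioc_of_mem {f c : ℕ → ℝ} (hf : Monotone f) {n k : ℕ} (hk : k < n) {x : ℝ}
    (hx : x ∈ Set.Ioc (f k) (f (k + 1))) :
    ∑ i ∈ Finset.range n, (Set.Ioc (f i) (f (i + 1))).indicator (fun _ => c i) x = c k := by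
  rw [Finset.sum_eq_single_of_mem k (Finset.mem_range.2 hk), Set.indicator_of_mem hx]
  intro i _ hik
  exact Set.indicator_of_notMem
    (fun hxi => Set.disjoint_left.1 (hf.pairwise_disjoint_on_Ioc_succ hik) hxi hx) _

theorem sq_emb_sub_stepApprox_le {N : ℕ} (hN : 0 < N) (e : FormDomain) :
    ∀ᵐ x, (emb e - stepApprox N e : RealL2) x ^ 2 ≤ 1 / N ^ 2 * wgt e x ^ 2
      + (Set.Ioc (-N : ℝ) N).indicator (fun _ => 1 / N ^ 2 * ‖der e‖ ^ 2) x := by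
  have hcover := (monotone_gridPt N).biUnion_Ico_Ioc_map_succ 0 (2 * N ^ 3)
  rw [gridPt_zero, gridPt_last hN] at hcover
  filter_upwards [coeFn_stepApprox N e, coeFn_emb e, coeFn_wgt e,
    Lp.coeFn_sub (emb e) (stepApprox N e)] with x hstep hemb hwgt hsub
  rw [hsub, Pi.sub_apply, hstep, hemb, hwgt, mul_pow, Real.sq_sqrt (by positivity)]
  by_cases hx : x ∈ Set.Ioc (-N : ℝ) N
  · obtain ⟨k, hk, hxk⟩ := Set.mem_iUnion₂.1 (hcover.symm ▸ hx)
    rw [sum_indicator_Ioc_of_mem (monotone_gridPt N) hk.2 hxk, Set.indicator_of_mem hx]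
    have hdist : |x - gridPt N k| ≤ 1 / N ^ 2 := by
      rw [abs_of_pos (sub_pos.2 hxk.1), ← gridPt_succ_sub N k]
      exact sub_le_sub_right hxk.2 _
    calc (fn e x - fn e (gridPt N k)) ^ 2 ≤ 1 / N ^ 2 * ‖der e‖ ^ 2 :=
          (sq_fn_sub_fn_le e _ x).trans (by gcongr)
      _ ≤ _ := le_add_of_nonneg_left (by positivity)
  · have hempty : ∀ i ∈ Finset.range (2 * N ^ 3),
        (Set.Ioc (gridPt N i) (gridPt N (i + 1))).indicator (fun _ => fn e (gridPt N i)) x = 0 :=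
      fun i hi => Set.indicator_of_notMem (fun hxi => hx (hcover ▸ Set.mem_iUnion₂.2
        ⟨i, ⟨Nat.zero_le i, Finset.mem_range.1 hi⟩, hxi⟩)) _
    rw [Finset.sum_eq_zero hempty, Set.indicator_of_notMem hx, sub_zero, add_zero, ← mul_assoc]
    have hfar : (N : ℝ) ^ 2 ≤ x ^ 2 := by
      rw [Set.mem_Ioc, not_and_or, not_lt, not_le] at hx
      rcases hx with hx | hx <;> nlinarith
    refine le_mul_of_one_le_left (sq_nonneg _) ?_
    rw [one_div_mul_eq_div, one_le_div (by positivity)]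
    linarith

theorem norm_stepApprox_sub_emb_le {N : ℕ} (hN : 0 < N) : ‖stepApprox N - emb‖ ≤ √(2 / N) := by
  refine ContinuousLinearMap.opNorm_le_bound _ (by positivity) fun e => ?_
  refine le_of_sq_le_sq ?_ (by positivity)
  have hcell : Integrable
      ((Set.Ioc (-N : ℝ) N).indicator fun _ => 1 / (N : ℝ) ^ 2 * ‖der e‖ ^ 2) :=
    (integrable_indicator_iff measurableSet_Ioc).2 (integrableOn_const measure_Ioc_lt_top.ne)
  have hweight : Integrable fun x => 1 / (N : ℝ) ^ 2 * wgt e x ^ 2 :=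
    (Lp.memLp (wgt e)).integrable_sq.const_mul _
  have hsmall : 1 / (N : ℝ) ^ 2 ≤ 2 / N := by
    have : (1 : ℝ) ≤ N := Nat.one_le_cast.2 hN
    rw [div_le_div_iff₀ (by positivity) (by positivity)]
    nlinarith
  calc ‖(stepApprox N - emb) e‖ ^ 2 = ∫ x, (emb e - stepApprox N e : RealL2) x ^ 2 := by
        rw [← RealL2.norm_sq, norm_sub_rev]
        rfl
    _ ≤ ∫ x, (1 / (N : ℝ) ^ 2 * wgt e x ^ 2
          + (Set.Ioc (-N : ℝ) N).indicator (fun _ => 1 / (N : ℝ) ^ 2 * ‖der e‖ ^ 2) x) :=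
        integral_mono_ae (Lp.memLp _).integrable_sq (hweight.add hcell)
          (sq_emb_sub_stepApprox_le hN e)
    _ = 1 / (N : ℝ) ^ 2 * ‖wgt e‖ ^ 2 + 2 / N * ‖der e‖ ^ 2 := by
        rw [integral_add hweight hcell, integral_const_mul, ← RealL2.norm_sq,
          integral_indicator measurableSet_Ioc, setIntegral_const, measureReal_def,
          Real.volume_Ioc, ENNReal.toReal_ofReal (by linarith [N.cast_nonneg (α := ℝ)]),
          smul_eq_mul]
        field_simp
        ring
    _ ≤ 2 / N * ‖wgt e‖ ^ 2 + 2 / N * ‖der e‖ ^ 2 := by gcongr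
    _ ≤ 2 / N * ‖e‖ ^ 2 := by
        rw [← mul_add, norm_sq_eq, add_comm (‖wgt e‖ ^ 2)]
        exact mul_le_mul_of_nonneg_left (le_add_of_nonneg_left (sq_nonneg _)) (by positivity)
    _ = (√(2 / N) * ‖e‖) ^ 2 := by rw [mul_pow, Real.sq_sqrt (by positivity)]

theorem isCompactOperator_emb : IsCompactOperator emb := by
  refine isCompactOperator_of_tendsto (l := atTop) (F := stepApprox) ?_
    (Eventually.of_forall isCompactOperator_stepApprox)
  have hlim : Tendsto (fun N : ℕ => √(2 / N)) atTop (nhds 0) := by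
    simpa using (tendsto_const_div_atTop_nhds_zero_nat (2 : ℝ)).sqrt
  refine (tendsto_iff_norm_sub_tendsto_zero (E := FormDomain →L[ℝ] RealL2)).2
    (squeeze_zero' (Eventually.of_forall fun N => norm_nonneg (stepApprox N - emb)) ?_ hlim)
  filter_upwards [eventually_gt_atTop 0] with N hN
  exact norm_stepApprox_sub_emb_le hN

end FormDomain

end Compactness

/-! ### The Schrödinger form -/

section SchrodingerForm

open scoped InnerProductSpace

open FormDomain

namespace FormDomain

theorem integrable_fn_mul_fn (e f : FormDomain) : Integrable fun x => fn e x * fn f x :=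
  (memLp_fn e).integrable_mul (memLp_fn f)

theorem abs_fn_mul_fn_le (e f : FormDomain) (x : ℝ) :
    ‖fn e x * fn f x‖ ≤ 2 * ‖e‖ * (2 * ‖f‖) := by
  rw [norm_mul]
  exact mul_le_mul (abs_fn_le e x) (abs_fn_le f x) (norm_nonneg _) (by positivity)

theorem integrable_mul_fn_mul_fn {q : ℝ → ℝ} (hq : Integrable q) (e f : FormDomain) :
    Integrable fun x => q x * (fn e x * fn f x) :=
  hq.mul_bdd ((continuous_fn e).mul (continuous_fn f)).aestronglyMeasurable
    (Eventually.of_forall (abs_fn_mul_fn_le e f))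

theorem wgt_mul_wgt (e f : FormDomain) :
    (fun x => wgt e x * wgt f x) =ᵐ[volume] fun x => (1 + x ^ 2) * (fn e x * fn f x) := by
  filter_upwards [coeFn_wgt e, coeFn_wgt f] with x hex hfx
  rw [hex, hfx, mul_mul_mul_comm, Real.mul_self_sqrt (by positivity)]

theorem integrable_weight_mul (e f : FormDomain) :
    Integrable fun x => (1 + x ^ 2) * (fn e x * fn f x) :=
  ((Lp.memLp (wgt e)).integrable_mul (Lp.memLp (wgt f))).congr (wgt_mul_wgt e f)

theorem integrable_potential_mul {q : ℝ → ℝ} (hq : Integrable q) (μ : ℝ) (e f : FormDomain) :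
    Integrable fun x => (x ^ 2 + q x - μ) * fn e x * fn f x := by
  refine (((integrable_weight_mul e f).add (integrable_mul_fn_mul_fn hq e f)).sub
    ((integrable_fn_mul_fn e f).const_mul (1 + μ))).congr (Eventually.of_forall fun x => ?_)
  simp only [Pi.add_apply, Pi.sub_apply]
  ring

end FormDomain

/-- The quadratic form of multiplication by an integrable potential. -/
noncomputable def potentialForm {q : ℝ → ℝ} (hq : Integrable q) :
    FormDomain →L[ℝ] FormDomain →L[ℝ] ℝ :=
  LinearMap.mkContinuous₂ (LinearMap.mk₂ ℝ (fun e f => ∫ x, q x * (fn e x * fn f x))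
    (fun e e' f => by
      rw [← integral_add (integrable_mul_fn_mul_fn hq _ _) (integrable_mul_fn_mul_fn hq _ _)]
      simp only [fn_add, add_mul, mul_add])
    (fun c e f => by
      rw [smul_eq_mul, ← integral_const_mul]
      simp only [fn_smul, mul_assoc, mul_left_comm])
    (fun e f f' => by
      rw [← integral_add (integrable_mul_fn_mul_fn hq _ _) (integrable_mul_fn_mul_fn hq _ _)]
      simp only [fn_add, mul_add])
    (fun c e f => by
      rw [smul_eq_mul, ← integral_const_mul]
      simp only [fn_smul, mul_left_comm]))
    (4 * ∫ x, |q x|) (fun e f => by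
      calc ‖∫ x, q x * (fn e x * fn f x)‖ ≤ ∫ x, |q x| * (2 * ‖e‖ * (2 * ‖f‖)) := by
            refine norm_integral_le_of_norm_le (hq.abs.mul_const _)
              (Eventually.of_forall fun x => ?_)
            rw [norm_mul]
            exact mul_le_mul_of_nonneg_left (abs_fn_mul_fn_le e f x) (norm_nonneg _)
        _ = 4 * (∫ x, |q x|) * ‖e‖ * ‖f‖ := by
            rw [integral_mul_const]
            ring)

/-- The pullback of the inner product under a continuous linear map. -/
noncomputable def pullbackInner {E F : Type*} [NormedAddCommGroup E] [NormedSpace ℝ E]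
    [NormedAddCommGroup F] [InnerProductSpace ℝ F] (T : E →L[ℝ] F) : E →L[ℝ] E →L[ℝ] ℝ :=
  isBoundedBilinearMap_inner.toContinuousLinearMap.bilinearComp T T

/-- A constant for which `-d²/dx² + x² + q + formShift q` has a coercive form. -/
noncomputable def formShift (q : ℝ → ℝ) : ℝ := 1 + 8 * (∫ x, |q x|) * ((∫ x, |q x|) + 1)

/-- The form of `-d²/dx² + x² + q + formShift q`; the weight already contributes `x² + 1`. -/
noncomputable def schrodingerForm {q : ℝ → ℝ} (hq : Integrable q) :
    FormDomain →L[ℝ] FormDomain →L[ℝ] ℝ :=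
  pullbackInner der + pullbackInner wgt + potentialForm hq + (formShift q - 1) • pullbackInner emb

variable {q : ℝ → ℝ}

theorem schrodingerForm_apply (hq : Integrable q) (e f : FormDomain) :
    schrodingerForm hq e f = ⟪der e, der f⟫_ℝ + ⟪wgt e, wgt f⟫_ℝ
      + (∫ x, q x * (fn e x * fn f x)) + (formShift q - 1) * ⟪emb e, emb f⟫_ℝ := rfl

theorem schrodingerForm_symm (hq : Integrable q) (e f : FormDomain) :
    schrodingerForm hq e f = schrodingerForm hq f e := by
  rw [schrodingerForm_apply, schrodingerForm_apply, real_inner_comm (der e),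
    real_inner_comm (wgt e), real_inner_comm (emb e)]
  simp_rw [mul_comm (fn e _)]

theorem schrodingerForm_eq_add (hq : Integrable q) (μ : ℝ) (e f : FormDomain) :
    schrodingerForm hq e f = (∫ x, der e x * der f x)
      + (∫ x, (x ^ 2 + q x - μ) * fn e x * fn f x) + (μ + formShift q) * ⟪emb e, emb f⟫_ℝ := by
  have hpotential : ∫ x, (x ^ 2 + q x - μ) * fn e x * fn f x
      = (∫ x, (1 + x ^ 2) * (fn e x * fn f x)) + (∫ x, q x * (fn e x * fn f x))
        - (1 + μ) * ∫ x, fn e x * fn f x := by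
    have hsum : Integrable fun x => (1 + x ^ 2) * (fn e x * fn f x) + q x * (fn e x * fn f x) :=
      (integrable_weight_mul e f).add (integrable_mul_fn_mul_fn hq e f)
    rw [← integral_const_mul, ← integral_add (integrable_weight_mul e f)
      (integrable_mul_fn_mul_fn hq e f), ← integral_sub hsum
      ((integrable_fn_mul_fn e f).const_mul _)]
    congr 1
    ext x
    ring
  rw [schrodingerForm_apply, RealL2.inner_eq, RealL2.inner_eq, integral_congr_ae (wgt_mul_wgt e f),
    hpotential, inner_emb_emb]
  ring

theorem abs_integral_mul_fn_sq_le (hq : Integrable q) (e : FormDomain) {δ : ℝ} (hδ : 0 < δ) :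
    |∫ x, q x * (fn e x * fn e x)|
      ≤ (∫ x, |q x|) * (2 / δ * ‖emb e‖ ^ 2 + 2 * δ * ‖der e‖ ^ 2) := by
  rw [← integral_mul_const, ← Real.norm_eq_abs]
  refine norm_integral_le_of_norm_le (hq.abs.mul_const _) (Eventually.of_forall fun x => ?_)
  rw [norm_mul, ← sq, norm_pow, Real.norm_eq_abs, Real.norm_eq_abs, sq_abs]
  exact mul_le_mul_of_nonneg_left (fn_sq_le e hδ x) (abs_nonneg _)

theorem isCoercive_schrodingerForm (hq : Integrable q) : IsCoercive (schrodingerForm hq) := by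
  refine ⟨1 / 6, by norm_num, fun e => ?_⟩
  simp only [schrodingerForm_apply, real_inner_self_eq_norm_sq]
  set Q := ∫ x, |q x| with hQ
  have : 0 ≤ Q := integral_nonneg fun x => abs_nonneg _
  -- The parameter of the Sobolev inequality that leaves half of `‖der e‖ ^ 2`.
  set δ : ℝ := 1 / (4 * (Q + 1)) with hδ
  have hδ0 : 0 < δ := by positivity
  have hshift : Q * (2 / δ) = formShift q - 1 := by
    rw [hδ, formShift, ← hQ]
    field_simp
    ring
  have hder : Q * (2 * δ) * ‖der e‖ ^ 2 ≤ 1 / 2 * ‖der e‖ ^ 2 := by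
    gcongr
    rw [hδ, mul_one_div, mul_div_assoc', div_le_iff₀ (by positivity)]
    linarith
  have hpotential := (abs_le.1 (abs_integral_mul_fn_sq_le hq e hδ0)).1
  rw [← hshift]
  nlinarith [norm_sq_le e, sq_nonneg ‖wgt e‖]

theorem mem_formEigenspace_emb_iff (hq : Integrable q) {μ : ℝ} {e : FormDomain} :
    e ∈ formEigenspace emb (schrodingerForm hq) (μ + formShift q) ↔
      ∀ f : FormDomain, (∫ x, der e x * der f x)
        + ∫ x, (x ^ 2 + q x - μ) * fn e x * fn f x = 0 :=
  mem_formEigenspace.trans (forall_congr' fun f => by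
    rw [schrodingerForm_eq_add hq μ, add_eq_right])

theorem exists_formDomain_of_contDiff {g : ℝ → ℝ} (hg : ContDiff ℝ 1 g)
    (hgc : HasCompactSupport g) : ∃ e : FormDomain, fn e = g ∧ der e =ᵐ[volume] deriv g :=
  (HasWeakDeriv.of_contDiff hg).exists_formDomain_of_hasCompactSupport
    ((hg.continuous_deriv le_rfl).memLp_of_hasCompactSupport hgc.deriv) hgc

theorem denseRange_emb : DenseRange emb := by
  change Dense (emb.range : Set RealL2)
  rw [Submodule.dense_iff_topologicalClosure_eq_top, Submodule.topologicalClosure_eq_top_iff,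
    Submodule.eq_bot_iff]
  intro v hv
  rw [Lp.eq_zero_iff_ae_eq_zero]
  refine ae_eq_zero_of_integral_contDiff_smul_eq_zero
    ((Lp.memLp v).locallyIntegrable one_le_two) fun g hg hgc => ?_
  obtain ⟨e, he, -⟩ := exists_formDomain_of_contDiff (hg.of_le (by exact_mod_cast le_top)) hgc
  have horth : ⟪v, emb e⟫_ℝ = 0 :=
    Submodule.inner_left_of_mem_orthogonal (LinearMap.mem_range_self _ e) hv
  rw [← horth, inner_emb, he]
  simp only [smul_eq_mul, mul_comm]

end SchrodingerForm

/-! ### Weak and classical eigenfunctions -/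

section DuBoisReymond

open scoped ContDiff

theorem exists_contDiff_deriv_eq_of_integral_eq_zero {f : ℝ → ℝ} (hf : ContDiff ℝ ∞ f)
    (hfc : HasCompactSupport f) (hzero : ∫ x, f x = 0) :
    ∃ g : ℝ → ℝ, ContDiff ℝ ∞ g ∧ HasCompactSupport g ∧ deriv g = f := by
  obtain ⟨R, hR⟩ := hfc.isCompact.isBounded.subset_ball 0
  rw [Real.ball_eq_Ioo, zero_sub, zero_add] at hR
  have hsupp : Function.support f ⊆ Set.Ioo (-R) R := (subset_tsupport f).trans hR
  have hderiv : ∀ x, HasDerivAt (fun x => ∫ t in (-R)..x, f t) (f x) x := fun x =>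
    hf.continuous.integral_hasStrictDerivAt (-R) x |>.hasDerivAt
  have hderiv_eq : deriv (fun x => ∫ t in (-R)..x, f t) = f := funext fun x => (hderiv x).deriv
  refine ⟨fun x => ∫ t in (-R)..x, f t, contDiff_infty_iff_deriv.2
    ⟨fun x => (hderiv x).differentiableAt, by rwa [hderiv_eq]⟩,
    .intro (isCompact_Icc (a := -R) (b := R)) fun x hx => ?_, hderiv_eq⟩
  rcases lt_or_ge x (-R) with hxR | hxR
  · rw [intervalIntegral.integral_symm, intervalIntegral.integral_of_le hxR.le, neg_eq_zero]
    refine setIntegral_eq_zero_of_forall_eq_zero fun t ht => ?_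
    exact Function.notMem_support.1 fun hts => (hsupp hts).1.not_ge ht.2
  · have hRx : R < x := not_le.1 fun hle => hx ⟨hxR, hle⟩
    rw [intervalIntegral.integral_eq_integral_of_support_subset
      (hsupp.trans fun t ht => ⟨ht.1, ht.2.le.trans hRx.le⟩), hzero]

/-- The du Bois-Reymond lemma: subtracting from a test function a multiple of a fixed bump makes it
a derivative of a test function. -/
theorem ae_eq_const_of_integral_mul_deriv_eq_zero {w : ℝ → ℝ} (hw : LocallyIntegrable w)
    (h : ∀ g : ℝ → ℝ, ContDiff ℝ ∞ g → HasCompactSupport g → ∫ x, w x * deriv g x = 0) :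
    ∃ m : ℝ, ∀ᵐ x, w x = m := by
  let η : ContDiffBump (0 : ℝ) := default
  have hη : ContDiff ℝ ∞ (η.normed volume) := η.contDiff_normed
  have hηc : HasCompactSupport (η.normed volume) := η.hasCompactSupport_normed
  have hint : ∀ {g : ℝ → ℝ}, ContDiff ℝ ∞ g → HasCompactSupport g →
      Integrable fun x => g x * w x :=
    fun hg hgc => hw.integrable_smul_left_of_hasCompactSupport hg.continuous hgc
  refine ⟨∫ x, η.normed volume x * w x, ae_eq_of_integral_contDiff_smul_eq hw
    (locallyIntegrable_const _) fun f hf hfc => ?_⟩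
  simp only [smul_eq_mul, integral_mul_const]
  obtain ⟨g, hg, hgc, hgf⟩ := exists_contDiff_deriv_eq_of_integral_eq_zero
    (f := fun x => f x - (∫ t, f t) * η.normed volume x) (hf.sub (contDiff_const.mul hη))
    (hfc.sub hηc.mul_left) (by
      rw [integral_sub (hf.continuous.integrable_of_hasCompactSupport hfc)
        ((hη.continuous.integrable_of_hasCompactSupport hηc).const_mul _), integral_const_mul,
        η.integral_normed, mul_one, sub_self])
  have hzero := h g hg hgc
  rw [hgf, integral_congr_ae (g := fun x => f x * w x - (∫ t, f t) * (η.normed volume x * w x))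
    (Eventually.of_forall fun x => by ring), integral_sub (hint hf hfc)
    ((hint hη hηc).const_mul _), integral_const_mul] at hzero
  exact sub_eq_zero.1 hzero

end DuBoisReymond

section WeakEqClassical

open FormDomain

variable {q : ℝ → ℝ} {μ : ℝ}

theorem intervalIntegrable_potential_mul (hq : Integrable q) (μ : ℝ) {u : ℝ → ℝ}
    (hu : Continuous u) (a b : ℝ) :
    IntervalIntegrable (fun x => (x ^ 2 + q x - μ) * u x) volume a b :=
  ((((continuous_pow 2).intervalIntegrable a b).add hq.intervalIntegrable).sub
    intervalIntegrable_const).mul_continuousOn hu.continuousOn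

theorem exists_hasWeakDeriv_der_ae_eq (hq : Integrable q) {e : FormDomain}
    (he : e ∈ formEigenspace emb (schrodingerForm hq) (μ + formShift q)) :
    ∃ d : ℝ → ℝ, HasWeakDeriv d (fun x => (x ^ 2 + q x - μ) * fn e x) ∧ der e =ᵐ[volume] d := by
  rw [mem_formEigenspace_emb_iff] at he
  set p : ℝ → ℝ := fun x => (x ^ 2 + q x - μ) * fn e x
  have hpi : ∀ a b, IntervalIntegrable p volume a b :=
    intervalIntegrable_potential_mul hq μ (continuous_fn e)
  set P : ℝ → ℝ := fun x => ∫ t in (0 : ℝ)..x, p t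
  have hPp : HasWeakDeriv P p := .of_primitive hpi (c := 0) fun x => (zero_add _).symm
  have hder : LocallyIntegrable (der e) := (Lp.memLp (der e)).locallyIntegrable one_le_two
  obtain ⟨m, hm⟩ := ae_eq_const_of_integral_mul_deriv_eq_zero
    (hder.sub hPp.continuous.locallyIntegrable) fun g hg hgc => by
      have hg1 : ContDiff ℝ 1 g := hg.of_le (by exact_mod_cast le_top)
      obtain ⟨f, hf, hf'⟩ := exists_formDomain_of_contDiff hg1 hgc
      have hgp : Integrable fun x => p x * g x := hf ▸ integrable_potential_mul hq μ e f
      have hdg : Integrable fun x => der e x * deriv g x :=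
        hder.integrable_smul_right_of_hasCompactSupport (hg1.continuous_deriv le_rfl) hgc.deriv
      have hPg : Integrable fun x => P x * deriv g x :=
        (hPp.continuous.mul (hg1.continuous_deriv le_rfl)).integrable_of_hasCompactSupport
          hgc.deriv.mul_left
      have hparts := (hPp.mul (.of_contDiff hg1)).integral_eq_zero
        ((hPp.continuous.mul hg.continuous).integrable_of_hasCompactSupport hgc.mul_left)
        (hgp.add hPg)
      have hweak := he f
      rw [hf, integral_congr_ae (hf'.mono fun x hx => congrArg (der e x * ·) hx)] at hweak
      rw [integral_add hgp hPg] at hparts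
      simp only [Pi.sub_apply, sub_mul]
      rw [integral_sub hdg hPg]
      linarith
  refine ⟨fun x => m + P x, .of_primitive hpi fun x => rfl, hm.mono fun x hx => ?_⟩
  exact sub_eq_iff_eq_add.1 hx

theorem fn_mem_schrodingerEigenspace (hq : Integrable q) {e : FormDomain}
    (he : e ∈ formEigenspace emb (schrodingerForm hq) (μ + formShift q)) :
    fn e ∈ schrodingerEigenspace (fun x => x ^ 2 + q x) μ := by
  obtain ⟨d, hd, hed⟩ := exists_hasWeakDeriv_der_ae_eq hq he
  have hderiv : ∀ x, HasDerivAt (fn e) (d x) x :=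
    (e.hasWeakDeriv.congr_ae hed).hasDerivAt hd.continuous
  have hderiv_eq : deriv (fn e) = d := funext fun x => (hderiv x).deriv
  refine ⟨fun x => (hderiv x).differentiableAt, fun a b => ?_, memLp_fn e, ?_⟩
  · rw [hderiv_eq]
    exact hd.absolutelyContinuousOnInterval a b
  · rw [hderiv_eq]
    filter_upwards [hd.ae_hasDerivAt] with x hx
    rw [hx.deriv]
    ring

/-- Smooth cutoff functions that exhaust the line: a fixed bump stretched by the factor `n + 1`. -/
noncomputable def cutoff (n : ℕ) (x : ℝ) : ℝ :=
  (default : ContDiffBump (0 : ℝ)) ((n + 1 : ℝ)⁻¹ * x)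

theorem contDiff_bump : ContDiff ℝ 1 (default : ContDiffBump (0 : ℝ)) := by
  exact_mod_cast ContDiffBump.contDiff _ (n := 1)

theorem contDiff_cutoff (n : ℕ) : ContDiff ℝ 1 (cutoff n) :=
  contDiff_bump.comp (contDiff_const.mul contDiff_id)

theorem hasCompactSupport_cutoff (n : ℕ) : HasCompactSupport (cutoff n) :=
  (ContDiffBump.hasCompactSupport _).comp_homeomorph
    (Homeomorph.mulLeft₀ (n + 1 : ℝ)⁻¹ (inv_ne_zero n.cast_add_one_ne_zero))

theorem cutoff_sq_le_one (n : ℕ) (x : ℝ) : cutoff n x ^ 2 ≤ 1 :=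
  pow_le_one₀ (ContDiffBump.nonneg _) (ContDiffBump.le_one _)

theorem tendsto_inv_natCast_add_one : Tendsto (fun n : ℕ => ((n : ℝ) + 1)⁻¹) atTop (nhds 0) := by
  simpa only [one_div] using tendsto_one_div_add_atTop_nhds_zero_nat (𝕜 := ℝ)

theorem tendsto_cutoff (x : ℝ) : Tendsto (fun n => cutoff n x) atTop (nhds 1) := by
  let η : ContDiffBump (0 : ℝ) := default
  have hη : η (0 * x) = 1 := by
    rw [zero_mul]
    exact η.one_of_mem_closedBall (Metric.mem_closedBall_self η.rIn_pos.le)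
  rw [← hη]
  exact (η.continuous.tendsto _).comp (tendsto_inv_natCast_add_one.mul_const x)

theorem exists_abs_deriv_cutoff_le : ∃ M : ℝ, ∀ n x, |deriv (cutoff n) x| ≤ (n + 1 : ℝ)⁻¹ * M := by
  let η : ContDiffBump (0 : ℝ) := default
  obtain ⟨M, hM⟩ := η.hasCompactSupport.deriv.exists_bound_of_continuous
    (contDiff_bump.continuous_deriv le_rfl)
  refine ⟨M, fun n x => ?_⟩
  rw [show cutoff n = fun x => η ((n + 1 : ℝ)⁻¹ * x) from rfl, deriv_comp_mul_left, smul_eq_mul,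
    abs_mul, abs_of_nonneg (by positivity)]
  exact mul_le_mul_of_nonneg_left (hM _) (by positivity)

theorem RealL2.memLp_of_tendsto {v : ℕ → RealL2} {K : ℝ} (hv : ∀ n, ‖v n‖ ≤ K) {w : ℝ → ℝ}
    (hlim : ∀ᵐ x, Tendsto (fun n => v n x) atTop (nhds (w x))) : MemLp w 2 := by
  have hmeas : ∀ n, AEStronglyMeasurable (v n) volume := fun n => Lp.aestronglyMeasurable (v n)
  refine ⟨aestronglyMeasurable_of_tendsto_ae atTop hmeas hlim, ?_⟩
  have hbound : ∀ n, eLpNorm (v n) 2 volume ≤ ENNReal.ofReal K := fun n => by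
    rw [← Lp.enorm_def, ← ofReal_norm]
    exact ENNReal.ofReal_le_ofReal (hv n)
  calc eLpNorm w 2 volume ≤ liminf (fun n => eLpNorm (v n) 2 volume) atTop :=
        Lp.eLpNorm_lim_le_liminf_eLpNorm hmeas w hlim
    _ ≤ ENNReal.ofReal K := liminf_le_of_frequently_le' (Frequently.of_forall hbound)
    _ < ⊤ := ENNReal.ofReal_lt_top

/-- The localization identity: for a solution `u` of the eigenvalue equation the potential only
enters the energy of `c u` through the eigenvalue, because `((c u)')² + (x² + q - μ) (c u)²` differs
from `(c' u)²` by the derivative of `c² u u'`. -/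
theorem exists_formDomain_localized (hq : Integrable q) {u u' : ℝ → ℝ} (hu : HasWeakDeriv u u')
    (hu' : HasWeakDeriv u' fun x => (x ^ 2 + q x - μ) * u x) {c : ℝ → ℝ} (hc : ContDiff ℝ 1 c)
    (hcc : HasCompactSupport c) :
    ∃ e : FormDomain, fn e = (fun x => c x * u x) ∧
      der e =ᵐ[volume] (fun x => deriv c x * u x + c x * u' x) ∧
      schrodingerForm hq e e
        = (∫ x, (deriv c x * u x) ^ 2) + (μ + formShift q) * ∫ x, (c x * u x) ^ 2 := by
  have hcont := hu.continuous
  have hcont' := hu'.continuous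
  have hccont := hc.continuous
  have := hc.continuous_deriv le_rfl
  have hcu := (HasWeakDeriv.of_contDiff hc).mul hu
  obtain ⟨e, he, he'⟩ := hcu.exists_formDomain_of_hasCompactSupport
    (Continuous.memLp_of_hasCompactSupport (by fun_prop) (hcc.deriv.mul_right.add hcc.mul_right))
    hcc.mul_right
  refine ⟨e, he, he', ?_⟩
  have hder : ∫ x, der e x * der e x = ∫ x, (deriv c x * u x + c x * u' x) ^ 2 :=
    integral_congr_ae (he'.mono fun x hx => by simp only [hx, sq])
  have hderi : Integrable fun x => (deriv c x * u x + c x * u' x) ^ 2 :=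
    (Lp.memLp (der e)).integrable_sq.congr (he'.mono fun x hx => by simp only [hx])
  have hpot : Integrable fun x => (x ^ 2 + q x - μ) * (c x * u x) * (c x * u x) := by
    simpa only [he] using integrable_potential_mul hq μ e e
  have hsum : Integrable fun x => (deriv c x * u x + c x * u' x) ^ 2
      + (x ^ 2 + q x - μ) * (c x * u x) * (c x * u x) := hderi.add hpot
  have hloc : Integrable fun x => (deriv c x * u x) ^ 2 :=
    Continuous.integrable_of_hasCompactSupport (by fun_prop)
      (by simpa only [sq] using! hcc.deriv.mul_right.mul_right (f' := fun x => deriv c x * u x))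
  have hparts := (((HasWeakDeriv.of_contDiff hc).mul hcu).mul hu').congr_ae
    (h := fun x => (deriv c x * u x + c x * u' x) ^ 2
      + (x ^ 2 + q x - μ) * (c x * u x) * (c x * u x) - (deriv c x * u x) ^ 2)
    (Eventually.of_forall fun x => by ring)
  have hzero := hparts.integral_eq_zero (hparts.continuous.integrable_of_hasCompactSupport
    hcc.mul_right.mul_right) (hsum.sub hloc)
  rw [integral_sub hsum hloc, integral_add hderi hpot] at hzero
  rw [schrodingerForm_eq_add hq μ, hder, inner_emb_emb, he]
  simp only [← sq (c _ * u _)]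
  linarith

theorem integral_mul_sq_le {c u : ℝ → ℝ} {M : ℝ} (hc : ∀ x, c x ^ 2 ≤ M) (hu : MemLp u 2) :
    ∫ x, (c x * u x) ^ 2 ≤ M * ∫ x, u x ^ 2 := by
  rw [← integral_const_mul]
  refine integral_mono_of_nonneg (Eventually.of_forall fun x => sq_nonneg _)
    (hu.integrable_sq.const_mul M) (Eventually.of_forall fun x => ?_)
  calc (c x * u x) ^ 2 = c x ^ 2 * u x ^ 2 := mul_pow _ _ _
    _ ≤ M * u x ^ 2 := mul_le_mul_of_nonneg_right (hc x) (sq_nonneg _)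

theorem exists_bounded_formDomain_tendsto (hq : Integrable q) {u u' : ℝ → ℝ}
    (hu : HasWeakDeriv u u') (hu' : HasWeakDeriv u' fun x => (x ^ 2 + q x - μ) * u x)
    (hu2 : MemLp u 2) :
    ∃ (K : ℝ) (e : ℕ → FormDomain), (∀ n, ‖e n‖ ≤ K) ∧
      (∀ x, Tendsto (fun n => fn (e n) x) atTop (nhds (u x))) ∧
      ∀ᵐ x, Tendsto (fun n => der (e n) x) atTop (nhds (u' x)) := by
  obtain ⟨M, hM⟩ := exists_abs_deriv_cutoff_le
  obtain ⟨C, hC, hcoercive⟩ := isCoercive_schrodingerForm hq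
  choose e he he' hform using fun n =>
    exists_formDomain_localized hq hu hu' (contDiff_cutoff n) (hasCompactSupport_cutoff n)
  have hderiv_sq : ∀ n x, deriv (cutoff n) x ^ 2 ≤ M ^ 2 := fun n x => by
    refine sq_le_sq.2 ((hM n x).trans ((le_abs_self _).trans ?_))
    rw [abs_mul, abs_of_nonneg (by positivity)]
    exact mul_le_of_le_one_left (abs_nonneg M)
      (inv_le_one_of_one_le₀ (le_add_of_nonneg_left n.cast_nonneg))
  have hnorm : ∀ n, ‖e n‖ ^ 2 ≤ (M ^ 2 + |μ + formShift q|) * (∫ x, u x ^ 2) / C := fun n => by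
    rw [le_div_iff₀' hC]
    calc C * ‖e n‖ ^ 2 ≤ schrodingerForm hq (e n) (e n) := by
          rw [sq, ← mul_assoc]
          exact hcoercive (e n)
      _ ≤ M ^ 2 * (∫ x, u x ^ 2) + |μ + formShift q| * (1 * ∫ x, u x ^ 2) := by
          rw [hform]
          exact add_le_add (integral_mul_sq_le (hderiv_sq n) hu2)
            (mul_le_mul (le_abs_self _) (integral_mul_sq_le (cutoff_sq_le_one n) hu2)
              (integral_nonneg fun x => sq_nonneg _) (abs_nonneg _))
      _ = (M ^ 2 + |μ + formShift q|) * ∫ x, u x ^ 2 := by ring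
  refine ⟨_, e, fun n => Real.le_sqrt_of_sq_le (hnorm n), fun x => ?_, ?_⟩
  · simpa only [he, one_mul] using (tendsto_cutoff x).mul_const (u x)
  · filter_upwards [ae_all_iff.2 he'] with x hx
    have hderiv : Tendsto (fun n => deriv (cutoff n) x) atTop (nhds 0) :=
      squeeze_zero_norm (fun n => hM n x) (by
        simpa only [zero_mul] using tendsto_inv_natCast_add_one.mul_const M)
    simpa only [hx, zero_mul, one_mul, zero_add] using
      (hderiv.mul_const (u x)).add ((tendsto_cutoff x).mul_const (u' x))

theorem exists_formDomain_of_eigenfunction (hq : Integrable q) {u u' : ℝ → ℝ}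
    (hu : HasWeakDeriv u u') (hu' : HasWeakDeriv u' fun x => (x ^ 2 + q x - μ) * u x)
    (hu2 : MemLp u 2) : ∃ e : FormDomain, fn e = u ∧ der e =ᵐ[volume] u' := by
  obtain ⟨K, e, hK, hfn, hder⟩ := exists_bounded_formDomain_tendsto hq hu hu' hu2
  refine hu.exists_formDomain
    (RealL2.memLp_of_tendsto (fun n => (norm_der_le (e n)).trans (hK n)) hder)
    (RealL2.memLp_of_tendsto (fun n => (norm_wgt_le (e n)).trans (hK n)) ?_)
  filter_upwards [ae_all_iff.2 fun n => coeFn_wgt (e n)] with x hx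
  simpa only [hx] using (hfn x).const_mul √(1 + x ^ 2)

theorem exists_fn_eq_of_mem_schrodingerEigenspace (hq : Integrable q) {u : ℝ → ℝ}
    (hu : u ∈ schrodingerEigenspace (fun x => x ^ 2 + q x) μ) :
    ∃ e ∈ formEigenspace emb (schrodingerForm hq) (μ + formShift q), fn e = u := by
  obtain ⟨hdiff, hac, hu2, hode⟩ := hu
  have hu'' : HasWeakDeriv (deriv u) fun x => (x ^ 2 + q x - μ) * u x :=
    (HasWeakDeriv.of_absolutelyContinuousOnInterval hac).congr_ae
      (hode.mono fun x hx => by linear_combination -hx)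
  obtain ⟨e, rfl, he'⟩ := exists_formDomain_of_eigenfunction hq
    (.of_hasDerivAt (fun x => (hdiff x).hasDerivAt) hu''.continuous) hu'' hu2
  refine ⟨e, (mem_formEigenspace_emb_iff hq).2 fun f => ?_, rfl⟩
  have hd2 : MemLp (deriv (fn e)) 2 := (Lp.memLp (der e)).ae_eq he'
  have hpot := integrable_potential_mul hq μ e f
  have hder : Integrable fun x => deriv (fn e) x * der f x :=
    hd2.integrable_mul (Lp.memLp (der f))
  rw [integral_congr_ae (he'.mono fun x hx => congrArg (· * der f x) hx), add_comm,
    ← integral_add hpot hder]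
  exact (hu''.mul f.hasWeakDeriv).integral_eq_zero (hd2.integrable_mul (memLp_fn f))
    (hpot.add hder)

/-- Weak eigenfunctions are exactly the classical ones. -/
noncomputable def formEigenspaceEquivSchrodinger (hq : Integrable q) (μ : ℝ) :
    formEigenspace emb (schrodingerForm hq) (μ + formShift q)
      ≃ₗ[ℝ] schrodingerEigenspace (fun x => x ^ 2 + q x) μ :=
  LinearEquiv.ofBijective
    ((LinearMap.pi fun x => (evalL x : FormDomain →ₗ[ℝ] ℝ)).restrict fun _ =>
      fn_mem_schrodingerEigenspace hq)
    ⟨fun _ _ hef => Subtype.ext (fn_injective (congrArg Subtype.val hef)), fun u => by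
      obtain ⟨e, he, heu⟩ := exists_fn_eq_of_mem_schrodingerEigenspace hq u.2
      exact ⟨⟨e, he⟩, Subtype.ext heu⟩⟩

end WeakEqClassical

section EigenvalueSequences

universe u

open FormDomain

theorem nonempty_basis_iff_mk_eq_rank {R : Type*} {I M : Type u} [Ring R] [StrongRankCondition R]
    [AddCommGroup M] [Module R M] [Module.Free R M] :
    Nonempty (Module.Basis I R M) ↔ Cardinal.mk I = Module.rank R M := by
  refine ⟨fun ⟨b⟩ => b.mk_eq_rank'', fun h => ?_⟩
  rw [Module.Free.rank_eq_card_chooseBasisIndex] at h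
  exact (Cardinal.eq.1 h).map fun i => (Module.Free.chooseBasis R M).reindex i.symm

theorem isFormEigenvalueSequence_add_formShift_iff {q : ℝ → ℝ} (hq : Integrable q) {l : ℕ → ℝ} :
    IsFormEigenvalueSequence emb (schrodingerForm hq) (fun k => l k + formShift q) ↔
      IsEigenvalueSequence (fun x => x ^ 2 + q x) l := by
  have hbasis : ∀ μ, Nonempty (Module.Basis {k // l k + formShift q = μ + formShift q} ℝ
      (formEigenspace emb (schrodingerForm hq) (μ + formShift q))) ↔
      Cardinal.mk {k // l k = μ} = Module.rank ℝ (schrodingerEigenspace (fun x => x ^ 2 + q x) μ) :=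
    fun μ => by
      simp only [add_left_inj]
      rw [nonempty_basis_iff_mk_eq_rank, (formEigenspaceEquivSchrodinger hq μ).rank_eq]
  refine ⟨fun h => ⟨fun i j hij => le_of_add_le_add_right (h.monotone hij), fun μ =>
    (hbasis μ).1 (h.nonempty_basis _)⟩, fun h => ⟨h.monotone.add_const _, fun μ => ?_⟩⟩
  obtain ⟨ν, rfl⟩ : ∃ ν, μ = ν + formShift q := ⟨_, (sub_add_cancel μ (formShift q)).symm⟩
  exact (hbasis ν).2 (h.multiplicity ν)

end EigenvalueSequences

/-! ### Hermite functions as trial functions -/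

section TrialFunctions

open scoped InnerProductSpace

open FormDomain

theorem hasWeakDeriv_hermiteFn (k : ℕ) : HasWeakDeriv (hermiteFn k) (hermiteFnDeriv k) :=
  .of_hasDerivAt (hasDerivAt_hermiteFn k) (by unfold hermiteFnDeriv; fun_prop)

theorem memLp_hermiteFnDeriv (k : ℕ) : MemLp (hermiteFnDeriv k) 2 :=
  (memLp_exp_half_mul_eval _).const_mul _

theorem memLp_hermiteFn (k : ℕ) : MemLp (hermiteFn k) 2 :=
  (memLp_exp_half_mul_eval _).const_mul _

theorem memLp_mul_hermiteFn (k : ℕ) : MemLp (fun x => x * hermiteFn k x) 2 := by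
  refine ((memLp_exp_half_mul_eval (X * hermiteH k)).const_mul
    (√(hermiteNormSq k))⁻¹).ae_eq (Eventually.of_forall fun x => ?_)
  simp only [hermiteFn, eval_mul, eval_X]
  ring

theorem exists_formDomain_hermiteFn (k : ℕ) :
    ∃ e : FormDomain, fn e = hermiteFn k ∧ der e =ᵐ[volume] hermiteFnDeriv k := by
  have hcont := (hasWeakDeriv_hermiteFn k).continuous
  refine (hasWeakDeriv_hermiteFn k).exists_formDomain (memLp_hermiteFnDeriv k) ?_
  rw [memLp_two_iff_integrable_sq (Continuous.aestronglyMeasurable (by fun_prop))]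
  refine ((memLp_hermiteFn k).integrable_sq.add (memLp_mul_hermiteFn k).integrable_sq).congr
    (Eventually.of_forall fun x => ?_)
  simp only [Pi.add_apply, mul_pow, Real.sq_sqrt (add_nonneg zero_le_one (sq_nonneg x))]
  ring

/-- The Hermite functions as elements of the form domain. -/
noncomputable def hermiteTrial (k : ℕ) : FormDomain := (exists_formDomain_hermiteFn k).choose

theorem fn_hermiteTrial (k : ℕ) : fn (hermiteTrial k) = hermiteFn k :=
  (exists_formDomain_hermiteFn k).choose_spec.1

theorem der_hermiteTrial (k : ℕ) : der (hermiteTrial k) =ᵐ[volume] hermiteFnDeriv k :=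
  (exists_formDomain_hermiteFn k).choose_spec.2

theorem orthonormal_emb_hermiteTrial : Orthonormal ℝ fun k => emb (hermiteTrial k) := by
  rw [orthonormal_iff_ite]
  intro m n
  rw [inner_emb_emb, fn_hermiteTrial, fn_hermiteTrial, integral_hermiteFn_mul]

theorem not_finiteDimensional_realL2 : ¬FiniteDimensional ℝ RealL2 := fun _ =>
  not_finite_iff_infinite.2 (inferInstance : Infinite ℕ)
    orthonormal_emb_hermiteTrial.linearIndependent.finite

variable {q : ℝ → ℝ}

theorem schrodingerForm_hermiteTrial (hq : Integrable q) (k : ℕ) :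
    schrodingerForm hq (hermiteTrial k) (hermiteTrial k)
      = harmonicEigenvalue k + (∫ x, q x * hermiteFn k x ^ 2) + formShift q := by
  have hder : ∫ x, der (hermiteTrial k) x * der (hermiteTrial k) x = ∫ x, hermiteFnDeriv k x ^ 2 :=
    integral_congr_ae ((der_hermiteTrial k).mono fun x hx => by simp only [hx, sq])
  have hnorm : ⟪emb (hermiteTrial k), emb (hermiteTrial k)⟫_ℝ = 1 := by
    rw [real_inner_self_eq_norm_sq, orthonormal_emb_hermiteTrial.1, one_pow]
  have hweight : Integrable fun x => x ^ 2 * hermiteFn k x ^ 2 := by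
    simpa only [mul_pow] using (memLp_mul_hermiteFn k).integrable_sq
  have hpotential : Integrable fun x => q x * hermiteFn k x ^ 2 := by
    simpa only [fn_hermiteTrial, ← sq] using
      integrable_mul_fn_mul_fn hq (hermiteTrial k) (hermiteTrial k)
  have hsplit : ∫ x, (x ^ 2 + q x - 0) * hermiteFn k x * hermiteFn k x
      = (∫ x, x ^ 2 * hermiteFn k x ^ 2) + ∫ x, q x * hermiteFn k x ^ 2 := by
    rw [← integral_add hweight hpotential]
    congr 1
    ext x
    ring
  rw [schrodingerForm_eq_add hq 0, hder, hnorm, fn_hermiteTrial, hsplit,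
    ← integral_hermiteFn_energy, integral_add (memLp_hermiteFnDeriv k).integrable_sq hweight]
  ring

theorem exists_isEigenvalueSequence (hq : Integrable q) :
    ∃ l : ℕ → ℝ, IsEigenvalueSequence (fun x => x ^ 2 + q x) l ∧ Tendsto l atTop atTop := by
  obtain ⟨l, hl, hlim⟩ := exists_isFormEigenvalueSequence isCompactOperator_emb
    (isCoercive_schrodingerForm hq) (schrodingerForm_symm hq) denseRange_emb
    not_finiteDimensional_realL2
  refine ⟨fun k => l k - formShift q, (isFormEigenvalueSequence_add_formShift_iff hq).1 ?_,
    tendsto_atTop_add_const_right _ _ hlim⟩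
  simpa only [sub_add_cancel] using hl

theorem sum_eigenvalue_sub_harmonicEigenvalue_le (hq : Integrable q) {l : ℕ → ℝ}
    (hl : IsEigenvalueSequence (fun x => x ^ 2 + q x) l) (n : ℕ) :
    ∑ k ∈ Finset.range (n + 1), (l k - harmonicEigenvalue k)
      ≤ ∑ k ∈ Finset.range (n + 1), ∫ x, q x * hermiteFn k x ^ 2 := by
  have hcoercive := isCoercive_schrodingerForm hq
  have hform := (isFormEigenvalueSequence_add_formShift_iff hq).2 hl
  obtain ⟨b, hb⟩ := hform.exists_hilbertBasis isCompactOperator_emb hcoercive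
    (schrodingerForm_symm hq) denseRange_emb
  have htrace := sum_eigenvalues_le_sum_form (isCoercive_apply_self_nonneg hcoercive)
    (schrodingerForm_symm hq) hform.monotone b hb orthonormal_emb_hermiteTrial n
  simp only [schrodingerForm_hermiteTrial, Finset.sum_add_distrib] at htrace
  rw [Finset.sum_sub_distrib]
  linarith

end TrialFunctions

theorem corollary5p3 (q : ℝ → ℝ) (hq : Integrable q volume) :
    (∃ l : ℕ → ℝ, IsEigenvalueSequence (fun x => x ^ 2 + q x) l ∧ Tendsto l atTop atTop) ∧
    ∀ l : ℕ → ℝ, IsEigenvalueSequence (fun x => x ^ 2 + q x) l →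
      ∀ n : ℕ,
        ∑ k ∈ Finset.range (n + 1),
            (l k - harmonicEigenvalue k
              - 1 / (Real.pi * √(harmonicEigenvalue k)) * ∫ x : ℝ, q x) ≤
          ∑ k ∈ Finset.range (n + 1),
            ((2 : ℝ) ^ k * ((2 * k)! : ℝ) / (k ! : ℝ) * ((n + 1).choose (k + 1) : ℝ)
                * hermiteCoeff q (2 * k)
              - 1 / (Real.pi * √(harmonicEigenvalue k)) * ∫ x : ℝ, q x) := by
  refine ⟨exists_isEigenvalueSequence hq, fun l hl n => ?_⟩
  have hsum := sum_eigenvalue_sub_harmonicEigenvalue_le hq hl n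
  rw [sum_integral_mul_hermiteFn_sq hq n] at hsum
  simpa only [Finset.sum_sub_distrib] using sub_le_sub_right hsum _
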